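/- **Setting.** Fix a finite set $P$ of parameters, clocks $x_1,\dots,x_n$ and a zero clock $x_0$, and $lb,ub:P\to\mathbb Z$. Parameter valuations are the maps $v:P\to\mathbb Z$ with $lb\le v\le ub$; clock valuations are the maps $\eta:\{x_0,\dots,x_n\}\to\mathbb R_{\ge0}$ with $\eta(x_0)=0$. Affine expressions have integer coefficients and variables in $P$. A guard is a finite conjunction of conditions $x_i-x_j\prec e$ with ${\prec}\in\{\le,<\}$ and $e$ an affine expression; it is simple if always $i=0$ or $j=0$. A parametric timed Büchi automaton (PTBA) $A$ has a finite set $L$ of locations, an initial location $l_0$, a finite set of transitions $l\xrightarrow{g,R}l'$ ($g$ a simple guard, $R$ a set of clocks), a simple guard $\mathrm{Inv}(l)$ for each location $l$, and a set $F\subseteq L$ of accepting locations. **Concrete semantics $[\![A]\!]_v$.** The states are the pairs $(l,\eta)$. Delays are $(l,\eta)\xrightarrow{d}(l,\eta+d)$ with $d\ge0$ and $(v,\eta+d)\models\mathrm{Inv}(l)$. Actions are $(l,\eta)\xrightarrow{act}(l',\eta\langle R\rangle)$ with $l\xrightarrow{g,R}l'$, $(v,\eta)\models g$ and $(v,\eta\langle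 R\rangle)\models\mathrm{Inv}(l')$, where $\langle R\rangle$ resets the clocks in $R$. An accepting run is an infinite sequence $s_0\xrightarrow{d_0}s_0'\xrightarrow{act}s_1\xrightarrow{d_1}s_1'\xrightarrow{act}\cdots$ with $s_0=(l_0,\mathbf 0)$ such that the location of $s_i$ is in $F$ for infinitely many $i$. Write $s\preccurlyeq s'$ if some time-abstracting simulation under $v$ relates $s$ to $s'$: a relation in which every delay is answered by a delay of some, possibly different, length, and every action by an action with the same source location, so that the resulting states are related again. **Symbolic semantics $[\![A]\!]$.** A CPDBM $(C,D)$ is a finite set $C$ of inequalities between affine expressions, together with a matrix $D$ of bounds $x_i-x_j\prec_{ij}e_{ij}$, $0\le i,j\le n$, where each $e_{ij}$ is an affine expression or $\infty$, such that $e_{ii}=0$ and $C$ implies $e_{0i}\le0$. Put $[\![C]\!]=\{v: lb\le v\le ub,\ v\models C\}$, and let $[\![C,D]\!]$ be the set of all $(v,\eta)$ such that $v\in[\![C]\!]$ and $\eta$ satisfies all bounds of $D$ under $v$. The symbolic states are the pairs $S=(l,Z)$ with $Z=[\![C,D]\!]$ for some CPDBM; $v$ is a parameter valuation of $S$ if $(v,\eta)\in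 Z$ for some $\eta$, and $(l,\eta)\in_vS$ means $(v,\eta)\in Z$. The operations are as follows. * Applying $x_i-x_j\prec e$ to $(C,D)$: let $c$ be the inequality "$(e_{ij},\prec_{ij})$ is at least as tight as $(e,\prec)$". If $C$ implies $\neg c$, replace the bound $(i,j)$ by $(e,\prec)$; if $C$ implies $c$, keep $(C,D)$; otherwise split into $(C\cup\{c\},D)$ and $C\cup\{\neg c\}$ with the replaced bound. Here a finite $e$ always replaces $e_{ij}=\infty$, and $e=\infty$ changes nothing. Conjunctions are applied one conjunct after the other. This gives the set $(C,D)[g]$. * Canonisation $(C,D)_c$: all results of the Floyd–Warshall loop over $k,i,j$ ($k$ outermost, $j$ innermost) which applies $x_i-x_j\,(\prec_{ik}\wedge\prec_{kj})\,e_{ik}+e_{kj}$ in this splitting sense. * Reset of $x_r$: for $i\ne j$ the bound $(i,j)$ becomes bound $(0,j)$ if $i=r$, and bound $(i,0)$ if $j=r$. Sets of clocks are reset one clock after the other. * Time successor ${}^\uparrow$: the bounds $(i,0)$ with $i\ne0$ become $(\infty,<)$. Initial states are the symbolic states $(l_0,[\![C,D]\!])$ with $(C,D)\in(C_0,E^\uparrow)[\mathrm{Inv}(l_0)]$,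 where $C_0=\{p\ge lb(p),\,p\le ub(p): p\in P\}$ and all bounds of $E$ are $(0,\le)$. There is a transition $(l,Z)\Rightarrow(l',Z')$ if there are a CPDBM $(C,D)$ with $Z=[\![C,D]\!]$, a transition $l\xrightarrow{g,R}l'$, and $M_1\in(C,D)[g]$, $M_2\in(M_1)_c$, $M_3\in(M_2\langle R\rangle^\uparrow)[\mathrm{Inv}(l')]$, $M_4\in(M_3)_c$ with $Z'=[\![M_4]\!]$. **Abstractions.** An abstraction $\alpha$ over $[\![A]\!]$ assigns to each symbolic state $S=(l,Z)$ a set $\alpha(S)$ of symbolic states such that * for each $S'=(l',Z')\in\alpha(S)$: $l'=l$, every parameter valuation $v$ of $S'$ is one of $S$, and then $(v,\eta)\in Z$ implies $(v,\eta)\in Z'$; * for each parameter valuation $v$ of $S$ some $S'\in\alpha(S)$ has $v$ as a parameter valuation; and for all $S'\in\alpha(S)$, all $v$ and all $s\in_vS'$ there is $s'\in_vS$ with $s\preccurlyeq s'$. It is finite if its image $\{\alpha(S)\}$ is finite. The transition system $[\![A]\!]^\alpha$ has the initial states $Q\in\alpha(S)$ with $S$ initial, and the transitions $Q\Rightarrow^\alpha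 Q'$ where $Q\Rightarrow S$ and $Q'\in\alpha(S)$ for some $S$. An accepting run of $[\![A]\!]^\alpha$ is an infinite path $Q_0\Rightarrow^\alpha Q_1\Rightarrow^\alpha\cdots$ from an initial state with infinitely many $Q_i$ whose location is in $F$; it respects $v$ if $v$ is a parameter valuation of every $Q_i$. **Theorem.** Let $A$ be a PTBA, $\alpha$ a finite abstraction over $[\![A]\!]$, and $v$ a parameter valuation with $lb\le v\le ub$. 1. If $[\![A]\!]_v$ has an accepting run, then $[\![A]\!]^\alpha$ has an accepting run respecting $v$. 2. Suppose that invariants hold on entry under $v$: for every transition $l\xrightarrow{g,R}l'$, every clock valuation $\eta$ with $(v,\eta)\models g$ and every $d\ge0$, if $(v,\eta\langle R\rangle+d)\models\mathrm{Inv}(l')$ then $(v,\eta\langle R\rangle)\models\mathrm{Inv}(l')$ (as is the case when invariants are conjunctions of upper bounds on clocks). Then $[\![A]\!]_v$ has an accepting run if and only if $[\![A]\!]^\alpha$ has an accepting run respecting $v$. -/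

import Mathlib

open scoped NNReal

namespace PTBA

section Basics

/-- Affine expressions `z₀ + ∑ zₚ p` with integer coefficients over the parameters `P`. -/
@[ext] structure AffExpr (P : Type*) where
  const : ℤ
  coeff : P → ℤ

instance {P : Type*} : Zero (AffExpr P) := ⟨⟨0, fun _ => 0⟩⟩

instance {P : Type*} : Add (AffExpr P) :=
  ⟨fun e e' => ⟨e.const + e'.const, fun p => e.coeff p + e'.coeff p⟩⟩

/-- The integer constant `z` as an affine expression. -/
def AffExpr.ofInt {P : Type*} (z : ℤ) : AffExpr P := ⟨z, fun _ => 0⟩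

open Classical in
/-- The parameter `p` as an affine expression. -/
noncomputable def AffExpr.ofParam {P : Type*} (p : P) : AffExpr P :=
  ⟨0, fun q => if q = p then 1 else 0⟩

/-- The value `e[v]`. -/
def AffExpr.eval {P : Type*} [Fintype P] (e : AffExpr P) (v : P → ℤ) : ℤ :=
  e.const + ∑ p, e.coeff p * v p

/-- `v ∈ Val_{lb,ub}(P)`. -/
def Bounded {P : Type*} (lb ub v : P → ℤ) : Prop := ∀ p, lb p ≤ v p ∧ v p ≤ ub p

/-- A valuation of `n` proper clocks `x₁, …, xₙ`; the zero clock is added in `ClockVal.val`. -/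
abbrev ClockVal (n : ℕ) := Fin n → ℝ≥0

/-- The value of the clock `xᵢ`, `0 ≤ i ≤ n`; the zero clock `x₀` has value `0`. -/
def ClockVal.val {n : ℕ} (η : ClockVal n) (i : Fin (n + 1)) : ℝ :=
  Fin.cases (motive := fun _ => ℝ) 0 (fun k => (η k : ℝ)) i

/-- `η + d`. -/
def ClockVal.delay {n : ℕ} (η : ClockVal n) (d : ℝ≥0) : ClockVal n := fun k => η k + d

/-- `η⟨R⟩`. -/
def ClockVal.reset {n : ℕ} (η : ClockVal n) (R : Finset (Fin (n + 1))) : ClockVal n :=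
  fun k => if k.succ ∈ R then 0 else η k

/-- A pair `(e, ≺)` with `e ∈ E(P) ∪ {∞}`; `nonstrict = true` stands for `≤` and
`nonstrict = false` for `<`. -/
structure Bound (P : Type*) where
  expr : WithTop (AffExpr P)
  nonstrict : Bool

/-- `r ≺ e[v]`, where everything is below `∞`. -/
def Bound.Holds {P : Type*} [Fintype P] (b : Bound P) (v : P → ℤ) (r : ℝ) : Prop :=
  ∀ e : AffExpr P, b.expr = (e : WithTop (AffExpr P)) →
    if b.nonstrict then r ≤ (e.eval v : ℝ) else r < (e.eval v : ℝ)

/-- An atomic guard `xᵢ - xⱼ ≺ e`, with `≺` encoded as in `Bound`. -/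
structure Atom (P : Type*) (n : ℕ) where
  i : Fin (n + 1)
  j : Fin (n + 1)
  nonstrict : Bool
  expr : AffExpr P

/-- The right-hand side of an atomic guard. -/
def Atom.bound {P : Type*} {n : ℕ} (a : Atom P n) : Bound P := ⟨a.expr, a.nonstrict⟩

/-- Guards: finite conjunctions of atomic guards. -/
abbrev Guard (P : Type*) (n : ℕ) := List (Atom P n)

/-- `(v, η) ⊨ g`. -/
def Guard.Sat {P : Type*} [Fintype P] {n : ℕ} (g : Guard P n) (v : P → ℤ) (η : ClockVal n) :
    Prop :=
  ∀ a ∈ g, a.bound.Holds v (η.val a.i - η.val a.j)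

/-- Simple guards: in every conjunct one of the two clocks is the zero clock. -/
abbrev SimpleGuard (P : Type*) (n : ℕ) := {g : Guard P n // ∀ a ∈ g, a.i = 0 ∨ a.j = 0}

/-- Parametric timed Büchi automata with locations `L`, parameters `P` and `n` clocks. -/
structure Automaton (L P : Type*) (n : ℕ) where
  init : L
  trans : Finset (L × SimpleGuard P n × Finset (Fin (n + 1)) × L)
  inv : L → SimpleGuard P n
  acc : Set L

end Basics

section Concrete

variable {L P : Type*} [Fintype P] {n : ℕ}

/-- States of the concrete semantics. -/
abbrev State (L : Type*) (n : ℕ) := L × ClockVal n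

/-- Delay transitions of the semantics under `v`. -/
def Automaton.DelayStep (A : Automaton L P n) (v : P → ℤ) (d : ℝ≥0) (s s' : State L n) : Prop :=
  s'.1 = s.1 ∧ s'.2 = s.2.delay d ∧ (A.inv s'.1).1.Sat v s'.2

/-- Action transitions of the semantics under `v`. -/
def Automaton.ActStep (A : Automaton L P n) (v : P → ℤ) (s s' : State L n) : Prop :=
  ∃ g R, (s.1, g, R, s'.1) ∈ A.trans ∧ g.1.Sat v s.2 ∧ s'.2 = s.2.reset R ∧
    (A.inv s'.1).1.Sat v s'.2

/-- `s 0 -d 0→ s' 0 -act→ s 1 -d 1→ s' 1 -act→ …` is a proper run of the semantics under `v`. -/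
structure Automaton.IsProperRun (A : Automaton L P n) (v : P → ℤ)
    (s s' : ℕ → State L n) (d : ℕ → ℝ≥0) : Prop where
  start : s 0 = (A.init, fun _ => 0)
  delay : ∀ i, A.DelayStep v (d i) (s i) (s' i)
  action : ∀ i, A.ActStep v (s' i) (s (i + 1))

/-- The concrete semantics under `v` has an accepting run. -/
def Automaton.HasAcceptingRun (A : Automaton L P n) (v : P → ℤ) : Prop :=
  ∃ s s' d, A.IsProperRun v s s' d ∧ {i | (s i).1 ∈ A.acc}.Infinite

/-- Time-abstracting simulations over the concrete semantics under `v`, where an action transition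
is labelled with its source location: related states have to answer each other with the same
label. -/
structure Automaton.IsTimeAbstractingSimulation (A : Automaton L P n) (v : P → ℤ)
    (R : State L n → State L n → Prop) : Prop where
  action : ∀ s₁ s₂ s₁', R s₁ s₂ → A.ActStep v s₁ s₁' →
    ∃ s₂', s₂.1 = s₁.1 ∧ A.ActStep v s₂ s₂' ∧ R s₁' s₂'
  delay : ∀ s₁ s₂ s₁' d₁, R s₁ s₂ → A.DelayStep v d₁ s₁ s₁' →
    ∃ d₂ s₂', A.DelayStep v d₂ s₂ s₂' ∧ R s₁' s₂'

/-- `s ≼ s'`: some time-abstracting simulation relates `s` to `s'`. -/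
def Automaton.Simulated (A : Automaton L P n) (v : P → ℤ) (s s' : State L n) : Prop :=
  ∃ R, A.IsTimeAbstractingSimulation v R ∧ R s s'

/-- Whenever a transition to `l'` is enabled and the invariant of `l'` holds some time after the
reset, it holds right after the reset already. This is so in particular if the invariants consist
of upper bounds on clocks. -/
def Automaton.InvariantsHoldOnEntry (A : Automaton L P n) (v : P → ℤ) : Prop :=
  ∀ l g R l', (l, g, R, l') ∈ A.trans → ∀ (η : ClockVal n) (d : ℝ≥0), g.1.Sat v η →
    (A.inv l').1.Sat v ((η.reset R).delay d) → (A.inv l').1.Sat v (η.reset R)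

end Concrete

section Matrices

variable {P : Type*} [Fintype P] {n : ℕ}

/-- Relation symbols of constraints. -/
inductive Cmp where
  | lt | le | gt | ge

/-- Constraints `e ∼ e'` on parameters. -/
structure Constraint (P : Type*) where
  lhs : AffExpr P
  cmp : Cmp
  rhs : AffExpr P

/-- `v ⊨ c`. -/
def Constraint.Sat (c : Constraint P) (v : P → ℤ) : Prop :=
  match c.cmp with
  | .lt => c.lhs.eval v < c.rhs.eval v
  | .le => c.lhs.eval v ≤ c.rhs.eval v
  | .gt => c.lhs.eval v > c.rhs.eval v
  | .ge => c.lhs.eval v ≥ c.rhs.eval v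

/-- The negation of a constraint. -/
def Constraint.neg {P : Type*} (c : Constraint P) : Constraint P :=
  match c.cmp with
  | .lt => ⟨c.lhs, .ge, c.rhs⟩
  | .le => ⟨c.lhs, .gt, c.rhs⟩
  | .gt => ⟨c.lhs, .le, c.rhs⟩
  | .ge => ⟨c.lhs, .lt, c.rhs⟩

/-- The semantics `⟦C⟧` of a constraint set, within the valuations that respect `lb` and `ub`. -/
def csem (lb ub : P → ℤ) (C : Finset (Constraint P)) : Set (P → ℤ) :=
  {v | Bounded lb ub v ∧ ∀ c ∈ C, c.Sat v}

/-- `C ⊨ c`. -/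
def Covers (lb ub : P → ℤ) (C : Finset (Constraint P)) (c : Constraint P) : Prop :=
  ∀ v ∈ csem lb ub C, c.Sat v

/-- A constraint set together with a matrix of bounds; the entry `D i j` is the right-hand side
of the guard `xᵢ - xⱼ ≺ᵢⱼ eᵢⱼ`. -/
structure CMatrix (P : Type*) (n : ℕ) where
  C : Finset (Constraint P)
  D : Fin (n + 1) → Fin (n + 1) → Bound P

/-- The semantics `⟦C, D⟧`. -/
def CMatrix.sem (lb ub : P → ℤ) (M : CMatrix P n) : Set ((P → ℤ) × ClockVal n) :=
  {w | w.1 ∈ csem lb ub M.C ∧ ∀ i j, (M.D i j).Holds w.1 (w.2.val i - w.2.val j)}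

/-- `(C, D)` is a constrained parametric difference bound matrix: `eᵢᵢ = 0`, and `C ⊨ e₀ᵢ ≤ 0`,
that is, the lower bounds `-e₀ᵢ` of the clocks are non-negative. -/
def CMatrix.IsCPDBM (lb ub : P → ℤ) (M : CMatrix P n) : Prop :=
  (∀ i, (M.D i i).expr = 0) ∧
  ∀ i, ∀ v ∈ csem lb ub M.C, ∃ e : AffExpr P, (M.D 0 i).expr = e ∧ e.eval v ≤ 0

/-- The reset of a single clock. -/
def CMatrix.resetClock {P : Type*} {n : ℕ} (M : CMatrix P n) (r : Fin (n + 1)) : CMatrix P n where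
  C := M.C
  D i j := if i ≠ j ∧ i = r then M.D 0 j else if i ≠ j ∧ j = r then M.D i 0 else M.D i j

/-- The reset of a set of clocks, one after the other. -/
def CMatrix.reset {P : Type*} {n : ℕ} (M : CMatrix P n) (R : Finset (Fin (n + 1))) :
    CMatrix P n :=
  (R.sort (· ≤ ·)).foldl CMatrix.resetClock M

/-- The time successor: the upper bounds on clocks are removed. -/
def CMatrix.up {P : Type*} {n : ℕ} (M : CMatrix P n) : CMatrix P n where
  C := M.C
  D i j := if i ≠ 0 ∧ j = 0 then ⟨⊤, false⟩ else M.D i j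

/-- Replacement of the entry `(i, j)`. -/
def CMatrix.set {P : Type*} {n : ℕ} (M : CMatrix P n) (i j : Fin (n + 1)) (b : Bound P) :
    CMatrix P n where
  C := M.C
  D k l := if k = i ∧ l = j then b else M.D k l

open Classical in
/-- Addition of a constraint. -/
noncomputable def CMatrix.addC {P : Type*} {n : ℕ} (M : CMatrix P n) (c : Constraint P) :
    CMatrix P n where
  C := insert c M.C
  D := M.D

/-- The constraint `e (≺ ⟹ ≺') e'`, which says that the bound `(e, ≺)` is at least as tight
as `(e', ≺')`. -/
def tighter {P : Type*} (e : AffExpr P) (ns : Bool) (e' : AffExpr P) (ns' : Bool) :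
    Constraint P :=
  ⟨e, if !ns || ns' then .le else .lt, e'⟩

open Classical in
/-- Application of `xᵢ - xⱼ ≺ e`. Here `e = ∞` changes nothing, and a finite bound always
replaces an infinite one. -/
noncomputable def CMatrix.apply (lb ub : P → ℤ) (M : CMatrix P n) (i j : Fin (n + 1))
    (b : Bound P) : Set (CMatrix P n) :=
  match b.expr, (M.D i j).expr with
  | ⊤, _ => {M}
  | (_ : AffExpr P), ⊤ => {M.set i j b}
  | (e : AffExpr P), (e' : AffExpr P) =>
    let c := tighter e' (M.D i j).nonstrict e b.nonstrict
    if Covers lb ub M.C c.neg then {M.set i j b}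
    else if Covers lb ub M.C c then {M}
    else {M.addC c, (M.addC c.neg).set i j b}

/-- Application of a conjunction of atomic guards, one after the other. -/
noncomputable def CMatrix.applyGuard (lb ub : P → ℤ) : Guard P n → CMatrix P n → Set (CMatrix P n)
  | [], M => {M}
  | a :: g, M =>
    {M'' | ∃ M' ∈ M.apply lb ub a.i a.j a.bound, M'' ∈ CMatrix.applyGuard lb ub g M'}

/-- The bound `(eᵢₖ + eₖⱼ, ≺ᵢₖ ∧ ≺ₖⱼ)`. -/
def Bound.comp {P : Type*} (b b' : Bound P) : Bound P :=
  ⟨b.expr + b'.expr, b.nonstrict && b'.nonstrict⟩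

/-- Steps of the nondeterministic Floyd-Warshall procedure. -/
inductive FWStep (lb ub : P → ℤ) : ℕ × ℕ × ℕ × CMatrix P n → ℕ × ℕ × ℕ × CMatrix P n → Prop
  | relax (k i j : Fin (n + 1)) (M M' : CMatrix P n)
      (h : M' ∈ M.apply lb ub i j ((M.D i k).comp (M.D k j))) :
      FWStep lb ub (k, i, j, M) (k, i, j + 1, M')
  | nextRow (k i : Fin (n + 1)) (M : CMatrix P n) :
      FWStep lb ub (k, i, n + 1, M) (k, i + 1, 0, M)
  | nextPivot (k : Fin (n + 1)) (M : CMatrix P n) :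
      FWStep lb ub (k, n + 1, 0, M) (k + 1, 0, 0, M)

/-- The canonical set `(C, D)_c`. -/
def CMatrix.canon (lb ub : P → ℤ) (M : CMatrix P n) : Set (CMatrix P n) :=
  {M' | Relation.ReflTransGen (FWStep lb ub) (0, 0, 0, M) (n + 1, 0, 0, M')}

open Classical in
/-- The constraints `p ≥ lb(p)` and `p ≤ ub(p)`, with the matrix `E` whose entries are `(0, ≤)`. -/
noncomputable def CMatrix.initial (lb ub : P → ℤ) : CMatrix P n where
  C := Finset.univ.image (fun p => ⟨.ofParam p, .ge, .ofInt (lb p)⟩) ∪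
    Finset.univ.image (fun p => ⟨.ofParam p, .le, .ofInt (ub p)⟩)
  D _ _ := ⟨0, true⟩

end Matrices

section Symbolic

variable {L P : Type*} [Fintype P] {n : ℕ}

/-- Symbolic states `(l, ⟦C, D⟧)`, where `(C, D)` is a CPDBM. -/
@[ext] structure SymState (L : Type*) {P : Type*} [Fintype P] (n : ℕ) (lb ub : P → ℤ) where
  loc : L
  zone : Set ((P → ℤ) × ClockVal n)
  isZone : ∃ M : CMatrix P n, M.IsCPDBM lb ub ∧ zone = M.sem lb ub

/-- The parameter valuations `v` of a symbolic state, that is, those with `(v, η)` in its zone for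
some clock valuation `η`. -/
def SymState.params {lb ub : P → ℤ} (S : SymState L n lb ub) : Set (P → ℤ) :=
  {v | ∃ η, (v, η) ∈ S.zone}

/-- `s ∈_v S`. -/
def SymState.Contains {lb ub : P → ℤ} (S : SymState L n lb ub) (v : P → ℤ) (s : State L n) :
    Prop :=
  s.1 = S.loc ∧ (v, s.2) ∈ S.zone

/-- Initial symbolic states. -/
def Automaton.SymInit (A : Automaton L P n) (lb ub : P → ℤ) : Set (SymState L n lb ub) :=
  {S | S.loc = A.init ∧
    ∃ M ∈ CMatrix.applyGuard lb ub (A.inv A.init).1 (CMatrix.initial lb ub).up,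
      S.zone = M.sem lb ub}

/-- The transition relation of the symbolic semantics. -/
def Automaton.SymStep (A : Automaton L P n) {lb ub : P → ℤ} (S S' : SymState L n lb ub) : Prop :=
  ∃ M : CMatrix P n, M.IsCPDBM lb ub ∧ S.zone = M.sem lb ub ∧
  ∃ g R, (S.loc, g, R, S'.loc) ∈ A.trans ∧
  ∃ M₁ ∈ CMatrix.applyGuard lb ub g.1 M,
  ∃ M₂ ∈ M₁.canon lb ub,
  ∃ M₃ ∈ CMatrix.applyGuard lb ub (A.inv S'.loc).1 (M₂.reset R).up,
  ∃ M₄ ∈ M₃.canon lb ub, S'.zone = M₄.sem lb ub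

/-- Abstractions over the symbolic semantics. -/
structure Automaton.IsAbstraction (A : Automaton L P n) {lb ub : P → ℤ}
    (α : SymState L n lb ub → Set (SymState L n lb ub)) : Prop where
  loc_eq : ∀ S, ∀ S' ∈ α S, S'.loc = S.loc
  params_subset : ∀ S, ∀ S' ∈ α S, S'.params ⊆ S.params
  zone_subset : ∀ S, ∀ S' ∈ α S, ∀ v ∈ S'.params, ∀ η, (v, η) ∈ S.zone → (v, η) ∈ S'.zone
  covers : ∀ S, ∀ v ∈ S.params, ∃ S' ∈ α S, v ∈ S'.params
  simulated : ∀ S, ∀ S' ∈ α S, ∀ v s, S'.Contains v s → ∃ s', S.Contains v s' ∧ A.Simulated v s s'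

/-- Initial states of the abstract transition system induced by `α`. -/
def Automaton.AbsInit (A : Automaton L P n) {lb ub : P → ℤ}
    (α : SymState L n lb ub → Set (SymState L n lb ub)) : Set (SymState L n lb ub) :=
  {Q | ∃ S ∈ A.SymInit lb ub, Q ∈ α S}

/-- Transitions of the abstract transition system induced by `α`. -/
def Automaton.AbsStep (A : Automaton L P n) {lb ub : P → ℤ}
    (α : SymState L n lb ub → Set (SymState L n lb ub)) (Q Q' : SymState L n lb ub) : Prop :=
  ∃ S, A.SymStep Q S ∧ Q' ∈ α S

/-- The abstract transition system induced by `α` has an accepting run that respects `v`. -/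
def Automaton.HasAbsAcceptingRun (A : Automaton L P n) {lb ub : P → ℤ}
    (α : SymState L n lb ub → Set (SymState L n lb ub)) (v : P → ℤ) : Prop :=
  ∃ Q : ℕ → SymState L n lb ub, Q 0 ∈ A.AbsInit α ∧ (∀ i, A.AbsStep α (Q i) (Q (i + 1))) ∧
    (∀ i, v ∈ (Q i).params) ∧ {i | (Q i).loc ∈ A.acc}.Infinite

end Symbolic

end PTBA

namespace PTBA

open scoped Pointwise

/-! ### Bounds as down-closed sets of reals, and the splitting operation -/

section Bounds

variable {P : Type*} [Fintype P] {n : ℕ} {lb ub v : P → ℤ}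

/-! Under a fixed `v`, every matrix entry is a down-closed set of reals (a half-line or all of ℝ),
and splitting becomes intersection: in a branch that contains `v`, applying a bound intersects one
entry with it.

Part 1. A symbolic step is an action followed by a delay, so zones track the states reached after
delays. Some branch of every split keeps the current valuation, and so does some member of the
abstraction; the abstract run is built by recursion.

Part 2. Zones are exact backwards: canonisation yields the triangle inequality, so that resets and
delays can be undone by a one-dimensional Helly argument, and every state of a symbolic successor
has a concrete predecessor (`exists_step_of_symStep`). The hypothesis on invariants enters here,
because a symbolic step checks the invariant only after the delay. Since all states of a member of
`α S` are simulated by states of `S`, abstract paths can be walked backwards up to simulation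
(`exists_follows_of_absPath`).

Backward walks alone give only finite paths, so a lasso is sought. Finiteness of `α` gives positions
`p < q` with `α (S p) = α (S q)` and an accepting location in between. Let `w` be the word of
locations from `p` to `q`. Every state of `Q p` is simulated by the end of a `w`-path that starts in
`Q p`; iterating gives states `f 0, f 1, …` of `Q p` such that `w ^ k` leads from `f (a + k)` to a
state simulating `f a`. A region argument (`exists_simulated`) finds `a < b` with `f b` simulated by
`f a`. Hence `w ^ (b - a)` leads from `f b` to a state simulating `f b`, and this loop can be
repeated forever (`acceptsFrom_of_loop`). One more backward walk joins it to the initial state. -/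

@[simp] theorem AffExpr.eval_zero (v : P → ℤ) : (0 : AffExpr P).eval v = 0 := by
  show (0 : ℤ) + ∑ p, 0 * v p = 0
  simp

@[simp] theorem AffExpr.eval_add (e e' : AffExpr P) (v : P → ℤ) :
    (e + e').eval v = e.eval v + e'.eval v := by
  show (e.const + e'.const) + ∑ p, (e.coeff p + e'.coeff p) * v p = _
  simp only [AffExpr.eval, add_mul, Finset.sum_add_distrib]
  ring

theorem AffExpr.eval_ofInt (z : ℤ) (v : P → ℤ) : (AffExpr.ofInt z).eval v = z := by
  simp [AffExpr.eval, AffExpr.ofInt]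

theorem AffExpr.eval_ofParam (p : P) (v : P → ℤ) : (AffExpr.ofParam p).eval v = v p := by
  classical
  simp [AffExpr.eval, AffExpr.ofParam, Finset.sum_ite_eq']

/-- The set of reals that satisfy a bound under `v`. -/
def Bound.vals (b : Bound P) (v : P → ℤ) : Set ℝ := {r | b.Holds v r}

theorem Bound.mem_vals {b : Bound P} {r : ℝ} : r ∈ b.vals v ↔ b.Holds v r := Iff.rfl

theorem Bound.vals_top (ns : Bool) : (⟨⊤, ns⟩ : Bound P).vals v = Set.univ := by
  ext r
  simp [Bound.vals, Bound.Holds]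

theorem Bound.vals_coe (e : AffExpr P) (ns : Bool) :
    (⟨(e : WithTop (AffExpr P)), ns⟩ : Bound P).vals v =
      if ns then Set.Iic (e.eval v : ℝ) else Set.Iio (e.eval v : ℝ) := by
  ext r
  cases ns <;> simp [Bound.vals, Bound.Holds]

theorem Bound.isLowerSet_vals (b : Bound P) (v : P → ℤ) : IsLowerSet (b.vals v) := by
  obtain ⟨e, ns⟩ := b
  induction e using WithTop.recTopCoe with
  | top => rw [Bound.vals_top]; exact isLowerSet_univ
  | coe e =>
    rw [Bound.vals_coe]
    split_ifs
    exacts [isLowerSet_Iic _, isLowerSet_Iio _]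

/-- A sum of two half-lines is closed only if both are, which is the conjunction of the relation
symbols. An infinite bound absorbs because no half-line is empty. -/
theorem Bound.vals_comp (b b' : Bound P) (v : P → ℤ) :
    (b.comp b').vals v = b.vals v + b'.vals v := by
  obtain ⟨e, ns⟩ := b
  obtain ⟨e', ns'⟩ := b'
  have key : ∀ (e : AffExpr P) (ns : Bool), ∃ z : ℝ,
      z ∈ (⟨(e : WithTop (AffExpr P)), ns⟩ : Bound P).vals v := by
    intro e ns
    refine ⟨e.eval v - 1, ?_⟩
    rw [Bound.vals_coe]
    split_ifs <;> simp
  induction e using WithTop.recTopCoe with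
  | top =>
    rw [Bound.comp]
    simp only [WithTop.top_add, Bound.vals_top]
    symm
    rw [Set.eq_univ_iff_forall]
    intro r
    induction e' using WithTop.recTopCoe with
    | top => rw [Bound.vals_top]; exact ⟨r, trivial, 0, trivial, by simp⟩
    | coe e' =>
      obtain ⟨z, hz⟩ := key e' ns'
      exact ⟨r - z, trivial, z, hz, by simp⟩
  | coe e =>
    induction e' using WithTop.recTopCoe with
    | top =>
      rw [Bound.comp]
      simp only [WithTop.add_top, Bound.vals_top]
      symm
      rw [Set.eq_univ_iff_forall]
      intro r
      obtain ⟨z, hz⟩ := key e ns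
      exact ⟨z, hz, r - z, trivial, by simp⟩
    | coe e' =>
      rw [Bound.comp]
      simp only [← WithTop.coe_add, Bound.vals_coe, AffExpr.eval_add, Int.cast_add]
      ext r
      rw [Set.mem_add]
      cases ns <;> cases ns' <;> simp only [Bool.and_self, Bool.and_false, Bool.false_and,
        Bool.false_eq_true, if_true, if_false, Set.mem_Iic, Set.mem_Iio] <;> constructor
      · exact fun h => ⟨e.eval v - (e.eval v + e'.eval v - r) / 2, by linarith,
          e'.eval v - (e.eval v + e'.eval v - r) / 2, by linarith, by ring⟩
      · rintro ⟨x, hx, y, hy, rfl⟩; linarith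
      · exact fun h => ⟨r - e'.eval v, by linarith, e'.eval v, le_rfl, by ring⟩
      · rintro ⟨x, hx, y, hy, rfl⟩; linarith
      · exact fun h => ⟨e.eval v, le_rfl, r - e.eval v, by linarith, by ring⟩
      · rintro ⟨x, hx, y, hy, rfl⟩; linarith
      · exact fun h => ⟨e.eval v, le_rfl, r - e.eval v, by linarith, by ring⟩
      · rintro ⟨x, hx, y, hy, rfl⟩; linarith

theorem Constraint.sat_neg (c : Constraint P) (v : P → ℤ) : c.neg.Sat v ↔ ¬ c.Sat v := by
  obtain ⟨e, k, e'⟩ := c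
  cases k <;> simp [Constraint.neg, Constraint.Sat]

theorem tighter_sat_iff (e e' : AffExpr P) (ns ns' : Bool) (v : P → ℤ) :
    (tighter e ns e' ns').Sat v ↔
      (⟨(e : WithTop (AffExpr P)), ns⟩ : Bound P).vals v ⊆
        (⟨(e' : WithTop (AffExpr P)), ns'⟩ : Bound P).vals v := by
  rw [Bound.vals_coe, Bound.vals_coe]
  cases ns <;> cases ns' <;> simp [tighter, Constraint.Sat, Set.Iic_subset_Iio]

theorem CMatrix.mem_csem_addC {M : CMatrix P n} {c : Constraint P} :
    v ∈ csem lb ub (M.addC c).C ↔ v ∈ csem lb ub M.C ∧ c.Sat v := by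
  simp only [csem, CMatrix.addC, Finset.mem_insert, forall_eq_or_imp, Set.mem_ofPred_eq]
  tauto

/-- The sets of differences `xᵢ - xⱼ` admitted by a matrix under `v`. -/
def CMatrix.vals (M : CMatrix P n) (v : P → ℤ) (i j : Fin (n + 1)) : Set ℝ := (M.D i j).vals v

theorem CMatrix.mem_sem {M : CMatrix P n} {η : ClockVal n} :
    (v, η) ∈ M.sem lb ub ↔ v ∈ csem lb ub M.C ∧ ∀ i j, η.val i - η.val j ∈ M.vals v i j := Iff.rfl

theorem CMatrix.isLowerSet_vals (M : CMatrix P n) (v : P → ℤ) (i j : Fin (n + 1)) :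
    IsLowerSet (M.vals v i j) := Bound.isLowerSet_vals _ _

/-- The case distinction of `apply`, with the splitting constraint known only through its meaning as
an inclusion. -/
theorem CMatrix.apply_eq (M : CMatrix P n) (i j : Fin (n + 1)) (b : Bound P) :
    (b.expr = ⊤ ∧ M.apply lb ub i j b = {M}) ∨
    (b.expr ≠ ⊤ ∧ (M.D i j).expr = ⊤ ∧ M.apply lb ub i j b = {M.set i j b}) ∨
    ∃ c : Constraint P, b.expr ≠ ⊤ ∧ (M.D i j).expr ≠ ⊤ ∧
      (∀ v, c.Sat v ↔ M.vals v i j ⊆ b.vals v) ∧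
      ((Covers lb ub M.C c.neg ∧ M.apply lb ub i j b = {M.set i j b}) ∨
      (Covers lb ub M.C c ∧ M.apply lb ub i j b = {M}) ∨
      M.apply lb ub i j b = {M.addC c, (M.addC c.neg).set i j b}) := by
  obtain ⟨e, ns⟩ := b
  rcases hD : M.D i j with ⟨e', ns'⟩
  unfold CMatrix.apply
  rw [hD]
  induction e using WithTop.recTopCoe with
  | top => left; simp
  | coe e =>
    right
    induction e' using WithTop.recTopCoe with
    | top => left; simp
    | coe e' =>
      right
      refine ⟨tighter e' ns' e ns, by simp, by simp, fun v => ?_, ?_⟩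
      · rw [tighter_sat_iff, CMatrix.vals, hD]
      · dsimp only
        split_ifs with h1 h2
        · exact Or.inl ⟨h1, rfl⟩
        · exact Or.inr (Or.inl ⟨h2, rfl⟩)
        · exact Or.inr (Or.inr rfl)

theorem Bound.vals_of_expr_eq_top {b : Bound P} (h : b.expr = ⊤) : b.vals v = Set.univ := by
  obtain ⟨e, ns⟩ := b
  cases h
  exact Bound.vals_top ns

theorem CMatrix.vals_set (M : CMatrix P n) (i j : Fin (n + 1)) (b : Bound P) (k l) :
    (M.set i j b).vals v k l = if k = i ∧ l = j then b.vals v else M.vals v k l := by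
  simp only [CMatrix.vals, CMatrix.set]
  split_ifs <;> rfl

/-- Under the valuations that a result of an application covers, the entry `(i, j)` is
intersected with the new bound. -/
theorem CMatrix.vals_of_mem_apply {M M' : CMatrix P n} {i j : Fin (n + 1)} {b : Bound P}
    (h : M' ∈ M.apply lb ub i j b) (hv : v ∈ csem lb ub M'.C) :
    v ∈ csem lb ub M.C ∧ ∀ k l, M'.vals v k l =
      if k = i ∧ l = j then M.vals v i j ∩ b.vals v else M.vals v k l := by
  have keep : M.vals v i j ⊆ b.vals v → ∀ k l, M.vals v k l =
      if k = i ∧ l = j then M.vals v i j ∩ b.vals v else M.vals v k l := by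
    intro hs k l
    split_ifs with hkl
    · rw [hkl.1, hkl.2, Set.inter_eq_left.2 hs]
    · rfl
  have repl : ∀ N : CMatrix P n, N.D = M.D → ¬ M.vals v i j ⊆ b.vals v →
      ∀ k l, (N.set i j b).vals v k l =
      if k = i ∧ l = j then M.vals v i j ∩ b.vals v else M.vals v k l := by
    intro N hN hs k l
    -- Down-closed sets of reals are comparable, so a replaced entry contains the new bound and
    -- replacement is intersection.
    have hs' := ((M.isLowerSet_vals v i j).total (b.isLowerSet_vals v)).resolve_left hs
    rw [CMatrix.vals_set, Set.inter_eq_right.2 hs']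
    simp only [CMatrix.vals, hN]
  rcases M.apply_eq (lb := lb) (ub := ub) i j b with ⟨h1, h2⟩ | ⟨h0, h1, h2⟩ |
    ⟨c, hb, hD, hc, ⟨h1, h2⟩ | ⟨h1, h2⟩ | h2⟩ <;> rw [h2] at h
  · obtain rfl : M' = M := h
    exact ⟨hv, keep (by rw [Bound.vals_of_expr_eq_top h1]; exact Set.subset_univ _)⟩
  · obtain rfl : M' = M.set i j b := h
    refine ⟨hv, fun k l => ?_⟩
    rw [CMatrix.vals_set, show M.vals v i j = Set.univ from Bound.vals_of_expr_eq_top h1,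
      Set.univ_inter]
  · obtain rfl : M' = M.set i j b := h
    refine ⟨hv, repl M rfl ?_⟩
    rw [← hc]
    exact (c.sat_neg v).1 (h1 v hv)
  · obtain rfl : M' = M := h
    exact ⟨hv, keep ((hc v).1 (h1 v hv))⟩
  · rcases h with h | h
    · subst h
      obtain ⟨hv1, hv2⟩ := CMatrix.mem_csem_addC.1 hv
      exact ⟨hv1, keep ((hc v).1 hv2)⟩
    · obtain rfl : M' = (M.addC c.neg).set i j b := h
      obtain ⟨hv1, hv2⟩ := (CMatrix.mem_csem_addC (M := M) (c := c.neg)).1 hv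
      exact ⟨hv1, repl (M.addC c.neg) rfl (by rw [← hc]; exact (c.sat_neg v).1 hv2)⟩

/-- The branch is the one whose constraint `v` satisfies. It remains a CPDBM because an entry is
replaced only by a strictly tighter one: this spares the diagonal and keeps the entries `(0, k)`
non-positive. -/
theorem CMatrix.exists_mem_apply {M : CMatrix P n} (hM : M.IsCPDBM lb ub) {η : ClockVal n}
    (hη : (v, η) ∈ M.sem lb ub) {i j : Fin (n + 1)} {b : Bound P}
    (hb : b.Holds v (η.val i - η.val j)) :
    ∃ M' ∈ M.apply lb ub i j b, M'.IsCPDBM lb ub ∧ (v, η) ∈ M'.sem lb ub := by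
  rw [CMatrix.mem_sem] at hη
  obtain ⟨hv, hη⟩ := hη
  -- On the diagonal the difference is 0, so the new bound admits all non-positive reals and
  -- tightens nothing.
  have diag : i = j → b.expr ≠ ⊤ → M.vals v i j ⊆ b.vals v := by
    rintro rfl _ r hr
    have h0 : (0 : ℝ) ∈ b.vals v := by simpa [Bound.mem_vals] using hb
    refine b.isLowerSet_vals v ?_ h0
    have := hM.1 i
    have hr' := hr 0 this
    rw [AffExpr.eval_zero] at hr'
    split_ifs at hr' <;> simp at hr' <;> linarith
  have sets : ∀ k l, η.val k - η.val l ∈ (M.set i j b).vals v k l := by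
    intro k l
    rw [CMatrix.vals_set]
    split_ifs with h
    · rw [h.1, h.2]; exact hb
    · exact hη k l
  have cp : ∀ N : CMatrix P n, N.D = M.D → csem lb ub N.C ⊆ csem lb ub M.C → i ≠ j →
      b.expr ≠ ⊤ → (M.D i j).expr ≠ ⊤ →
      (∀ w ∈ csem lb ub N.C, ¬ M.vals w i j ⊆ b.vals w) →
      (N.set i j b).IsCPDBM lb ub := by
    intro N hN hC hij hbt hDt hw
    constructor
    · intro k
      simp only [CMatrix.set]
      rw [if_neg (by rintro ⟨rfl, rfl⟩; exact hij rfl), hN]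
      exact hM.1 k
    · intro k w hwC
      obtain ⟨e, he, he0⟩ := hM.2 k w (hC hwC)
      by_cases h : (0 : Fin (n + 1)) = i ∧ k = j
      · obtain ⟨rfl, rfl⟩ := h
        obtain ⟨e', he'⟩ := WithTop.ne_top_iff_exists.1 hbt
        simp only [CMatrix.set, and_self, if_true]
        refine ⟨e', he'.symm, ?_⟩
        -- A positive new bound would contain the old entry, whose bound is at most 0.
        by_contra hlt
        refine hw w hwC fun r hr => ?_
        have hr' := hr e he
        intro e'' he''
        obtain rfl : e' = e'' := by
          rw [← he'] at he''; exact WithTop.coe_injective he''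
        have h1 : r ≤ (e.eval w : ℝ) := by
          split_ifs at hr'
          exacts [hr', hr'.le]
        have h2 : (e.eval w : ℝ) ≤ 0 := by exact_mod_cast he0
        have h3 : (0 : ℝ) < (e'.eval w : ℝ) := by exact_mod_cast not_le.1 hlt
        split_ifs <;> linarith
      · refine ⟨e, ?_, he0⟩
        simp only [CMatrix.set]
        rw [if_neg h, hN]
        exact he
  rcases M.apply_eq (lb := lb) (ub := ub) i j b with ⟨h1, h2⟩ | ⟨h0, h1, h2⟩ |
    ⟨c, hbt, hDt, hc, ⟨h1, h2⟩ | ⟨h1, h2⟩ | h2⟩ <;> rw [h2]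
  · exact ⟨M, rfl, hM, hv, hη⟩
  · refine ⟨_, rfl, ⟨fun k => ?_, fun k w hw => ?_⟩, hv, sets⟩
    · simp only [CMatrix.set]
      rw [if_neg]
      · exact hM.1 k
      · rintro ⟨rfl, rfl⟩
        rw [hM.1] at h1
        exact absurd h1 (by exact WithTop.coe_ne_top (a := (0 : AffExpr P)))
    · simp only [CMatrix.set]
      rw [if_neg]
      · exact hM.2 k w hw
      · rintro ⟨rfl, rfl⟩
        obtain ⟨e, he, -⟩ := hM.2 k w hw
        rw [he] at h1
        exact WithTop.coe_ne_top h1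
  · have hs : ∀ w ∈ csem lb ub M.C, ¬ M.vals w i j ⊆ b.vals w := fun w hw => by
      rw [← hc]; exact (c.sat_neg w).1 (h1 w hw)
    exact ⟨_, rfl, cp M rfl subset_rfl (fun h => hs v hv (diag h hbt)) hbt hDt hs, hv, sets⟩
  · exact ⟨M, rfl, hM, hv, hη⟩
  · by_cases hcv : c.Sat v
    · refine ⟨_, Or.inl rfl, ⟨hM.1, fun k w hw => hM.2 k w ?_⟩, ?_, hη⟩
      · exact (CMatrix.mem_csem_addC.1 hw).1
      · exact CMatrix.mem_csem_addC.2 ⟨hv, hcv⟩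
    · refine ⟨_, Or.inr rfl, cp (M.addC c.neg) rfl ?_ ?_ hbt hDt ?_, ?_, ?_⟩
      · exact fun w hw => (CMatrix.mem_csem_addC.1 hw).1
      · exact fun h => hcv ((hc v).2 (diag h hbt))
      · intro w hw
        rw [← hc]
        exact (c.sat_neg w).1 (CMatrix.mem_csem_addC.1 hw).2
      · exact CMatrix.mem_csem_addC.2 ⟨hv, (c.sat_neg v).2 hcv⟩
      · exact sets

end Bounds

/-! ### Operations on matrices preserve membership of valuations -/

section Forward

variable {P : Type*} [Fintype P] {n : ℕ} {lb ub v : P → ℤ}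

@[simp] theorem ClockVal.val_zero (η : ClockVal n) : η.val 0 = 0 := rfl

@[simp] theorem ClockVal.val_succ (η : ClockVal n) (k : Fin n) : η.val k.succ = η k := rfl

theorem ClockVal.val_nonneg (η : ClockVal n) (i : Fin (n + 1)) : 0 ≤ η.val i := by
  induction i using Fin.cases with
  | zero => simp
  | succ k => simp

theorem ClockVal.val_delay (η : ClockVal n) (d : ℝ≥0) {i : Fin (n + 1)} (hi : i ≠ 0) :
    (η.delay d).val i = η.val i + d := by
  obtain ⟨k, rfl⟩ := Fin.exists_succ_eq.2 hi
  simp [ClockVal.delay]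

theorem ClockVal.val_reset (η : ClockVal n) (R : Finset (Fin (n + 1))) (i : Fin (n + 1)) :
    (η.reset R).val i = if i ∈ R then 0 else η.val i := by
  induction i using Fin.cases with
  | zero => simp
  | succ k => by_cases h : k.succ ∈ R <;> simp [ClockVal.reset, h]

theorem ClockVal.ext_val {η η' : ClockVal n} (h : ∀ i, i ≠ 0 → η.val i = η'.val i) : η = η' := by
  funext k
  simpa using h k.succ (Fin.succ_ne_zero k)

theorem CMatrix.exists_mem_applyGuard {η : ClockVal n} (g : Guard P n) (hg : g.Sat v η)
    {M : CMatrix P n} (hM : M.IsCPDBM lb ub) (hη : (v, η) ∈ M.sem lb ub) :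
    ∃ M' ∈ CMatrix.applyGuard lb ub g M, M'.IsCPDBM lb ub ∧ (v, η) ∈ M'.sem lb ub := by
  induction g generalizing M with
  | nil => exact ⟨M, rfl, hM, hη⟩
  | cons a g ih =>
    obtain ⟨M₁, h1, hM₁, hη₁⟩ := CMatrix.exists_mem_apply hM hη (hg a List.mem_cons_self)
    obtain ⟨M₂, h2, hM₂, hη₂⟩ := ih (fun b hb => hg b (List.mem_cons_of_mem _ hb)) hM₁ hη₁
    exact ⟨M₂, ⟨M₁, h1, h2⟩, hM₂, hη₂⟩

/-- Every bound applied is implied by two present ones, as `xᵢ - xⱼ = (xᵢ - xₖ) + (xₖ - xⱼ)`, so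
some branch keeps `η` at each step. The three inductions are the loops over `j`, `i` and `k`. -/
theorem CMatrix.exists_mem_canon {η : ClockVal n} {M : CMatrix P n} (hM : M.IsCPDBM lb ub)
    (hη : (v, η) ∈ M.sem lb ub) :
    ∃ M' ∈ M.canon lb ub, M'.IsCPDBM lb ub ∧ (v, η) ∈ M'.sem lb ub := by
  have row : ∀ (k i : Fin (n + 1)) (M : CMatrix P n), M.IsCPDBM lb ub → (v, η) ∈ M.sem lb ub →
      ∀ j : ℕ, j ≤ n + 1 → ∃ M' : CMatrix P n, Relation.ReflTransGen (FWStep lb ub)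
        ((k : ℕ), (i : ℕ), 0, M) ((k : ℕ), (i : ℕ), j, M') ∧
        M'.IsCPDBM lb ub ∧ (v, η) ∈ M'.sem lb ub := by
    intro k i M hM hη j hj
    induction j with
    | zero => exact ⟨M, .refl, hM, hη⟩
    | succ j ih =>
      obtain ⟨M₁, h1, hM₁, hη₁⟩ := ih (by omega)
      obtain ⟨M₂, h2, hM₂, hη₂⟩ := CMatrix.exists_mem_apply hM₁ hη₁ (i := i) (j := ⟨j, hj⟩)
        (b := (M₁.D i k).comp (M₁.D k ⟨j, hj⟩)) (by
          rw [← Bound.mem_vals, Bound.vals_comp]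
          exact ⟨_, (CMatrix.mem_sem.1 hη₁).2 i k, _, (CMatrix.mem_sem.1 hη₁).2 k ⟨j, hj⟩, by simp⟩)
      exact ⟨M₂, h1.tail (FWStep.relax k i ⟨j, hj⟩ M₁ M₂ h2), hM₂, hη₂⟩
  have rows : ∀ (k : Fin (n + 1)) (M : CMatrix P n), M.IsCPDBM lb ub → (v, η) ∈ M.sem lb ub →
      ∀ i : ℕ, i ≤ n + 1 → ∃ M' : CMatrix P n, Relation.ReflTransGen (FWStep lb ub)
        ((k : ℕ), 0, 0, M) ((k : ℕ), i, 0, M') ∧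
        M'.IsCPDBM lb ub ∧ (v, η) ∈ M'.sem lb ub := by
    intro k M hM hη i hi
    induction i with
    | zero => exact ⟨M, .refl, hM, hη⟩
    | succ i ih =>
      obtain ⟨M₁, h1, hM₁, hη₁⟩ := ih (by omega)
      obtain ⟨M₂, h2, hM₂, hη₂⟩ := row k ⟨i, hi⟩ M₁ hM₁ hη₁ (n + 1) le_rfl
      exact ⟨M₂, (h1.trans h2).tail (FWStep.nextRow k ⟨i, hi⟩ M₂), hM₂, hη₂⟩
  have pivots : ∀ k : ℕ, k ≤ n + 1 → ∃ M' : CMatrix P n, Relation.ReflTransGen (FWStep lb ub)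
        (0, 0, 0, M) (k, 0, 0, M') ∧ M'.IsCPDBM lb ub ∧ (v, η) ∈ M'.sem lb ub := by
    intro k hk
    induction k with
    | zero => exact ⟨M, .refl, hM, hη⟩
    | succ k ih =>
      obtain ⟨M₁, h1, hM₁, hη₁⟩ := ih (by omega)
      obtain ⟨M₂, h2, hM₂, hη₂⟩ := rows ⟨k, hk⟩ M₁ hM₁ hη₁ (n + 1) le_rfl
      exact ⟨M₂, (h1.trans h2).tail (FWStep.nextPivot ⟨k, hk⟩ M₂), hM₂, hη₂⟩
  exact pivots (n + 1) le_rfl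

theorem CMatrix.IsCPDBM.resetClock {M : CMatrix P n} (hM : M.IsCPDBM lb ub) (r : Fin (n + 1)) :
    (M.resetClock r).IsCPDBM lb ub := by
  refine ⟨fun i => by simpa [CMatrix.resetClock] using hM.1 i, fun i w hw => ?_⟩
  simp only [CMatrix.resetClock]
  split_ifs
  exacts [hM.2 i w hw, ⟨0, hM.1 0, by simp⟩, hM.2 i w hw]

theorem CMatrix.IsCPDBM.reset {M : CMatrix P n} (hM : M.IsCPDBM lb ub)
    (R : Finset (Fin (n + 1))) : (M.reset R).IsCPDBM lb ub := by
  unfold CMatrix.reset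
  generalize R.sort (· ≤ ·) = l
  induction l generalizing M with
  | nil => exact hM
  | cons r l ih => exact ih (hM.resetClock r)

theorem CMatrix.IsCPDBM.up {M : CMatrix P n} (hM : M.IsCPDBM lb ub) : M.up.IsCPDBM lb ub := by
  refine ⟨fun i => ?_, fun i w hw => ?_⟩
  · simp only [CMatrix.up]
    rw [if_neg (by rintro ⟨h, rfl⟩; exact h rfl)]
    exact hM.1 i
  · simpa [CMatrix.up] using hM.2 i w hw

theorem ClockVal.reset_insert (η : ClockVal n) (r : Fin (n + 1)) (R : Finset (Fin (n + 1))) :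
    η.reset (insert r R) = (η.reset {r}).reset R := by
  funext k
  by_cases h : k.succ = r <;> by_cases h' : k.succ ∈ R <;> simp [ClockVal.reset, h, h']

theorem ClockVal.reset_empty (η : ClockVal n) : η.reset ∅ = η := by
  funext k
  simp [ClockVal.reset]

theorem CMatrix.mem_sem_resetClock {M : CMatrix P n} {η : ClockVal n}
    (hη : (v, η) ∈ M.sem lb ub) (r : Fin (n + 1)) :
    (v, η.reset {r}) ∈ (M.resetClock r).sem lb ub := by
  rw [CMatrix.mem_sem] at hη ⊢
  refine ⟨hη.1, fun i j => ?_⟩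
  simp only [CMatrix.vals, CMatrix.resetClock, ClockVal.val_reset, Finset.mem_singleton]
  by_cases hij : i = j
  · subst hij
    simpa [CMatrix.vals] using hη.2 i i
  · by_cases hi : i = r
    · have hj : j ≠ r := fun h => hij (hi.trans h.symm)
      simpa [hij, hi, hj, hj.symm, CMatrix.vals] using hη.2 0 j
    · by_cases hj : j = r
      · simpa [hij, hi, hj, CMatrix.vals] using hη.2 i 0
      · simpa [hi, hj, CMatrix.vals] using hη.2 i j

theorem CMatrix.mem_sem_reset {M : CMatrix P n} {η : ClockVal n}
    (hη : (v, η) ∈ M.sem lb ub) (R : Finset (Fin (n + 1))) :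
    (v, η.reset R) ∈ (M.reset R).sem lb ub := by
  have key : ∀ (l : List (Fin (n + 1))) (M : CMatrix P n) (η : ClockVal n),
      (v, η) ∈ M.sem lb ub → (v, η.reset l.toFinset) ∈ (l.foldl CMatrix.resetClock M).sem lb ub := by
    intro l
    induction l with
    | nil => intro M η h; rw [List.toFinset_nil, ClockVal.reset_empty]; exact h
    | cons r l ih =>
      intro M η h
      rw [List.toFinset_cons, ClockVal.reset_insert]
      exact ih _ _ (CMatrix.mem_sem_resetClock h r)
  simpa [Finset.sort_toFinset, CMatrix.reset] using key (R.sort (· ≤ ·)) M η hη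

theorem CMatrix.vals_up (M : CMatrix P n) (i j : Fin (n + 1)) :
    M.up.vals v i j = if i ≠ 0 ∧ j = 0 then Set.univ else M.vals v i j := by
  simp only [CMatrix.vals, CMatrix.up]
  split_ifs
  · exact Bound.vals_top _
  · rfl

theorem CMatrix.mem_sem_up {M : CMatrix P n} {η : ClockVal n}
    (hη : (v, η) ∈ M.sem lb ub) (d : ℝ≥0) : (v, η.delay d) ∈ M.up.sem lb ub := by
  rw [CMatrix.mem_sem] at hη ⊢
  refine ⟨hη.1, fun i j => ?_⟩
  rw [CMatrix.vals_up]
  split_ifs with h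
  · trivial
  -- A delay keeps the differences of proper clocks and decreases `x₀ - xⱼ`; down-closedness does
  -- the rest.
  · refine M.isLowerSet_vals v i j ?_ (hη.2 i j)
    by_cases hi : i = 0
    · subst hi
      by_cases hj : j = 0
      · subst hj; simp
      · rw [ClockVal.val_delay _ _ hj]
        simp
    · have hj : j ≠ 0 := fun hj => h ⟨hi, hj⟩
      rw [ClockVal.val_delay _ _ hj, ClockVal.val_delay _ _ hi]
      simp

theorem CMatrix.isCPDBM_initial : (CMatrix.initial lb ub : CMatrix P n).IsCPDBM lb ub :=
  ⟨fun _ => rfl, fun _ _ _ => ⟨0, rfl, by simp⟩⟩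

theorem CMatrix.vals_initial (i j : Fin (n + 1)) :
    (CMatrix.initial lb ub).vals v i j = Set.Iic 0 := by
  have := Bound.vals_coe (v := v) (0 : AffExpr P) true
  simp only [AffExpr.eval_zero, if_true, Int.cast_zero] at this
  exact this

theorem CMatrix.mem_sem_initial (hv : Bounded lb ub v) :
    (v, fun _ => 0) ∈ (CMatrix.initial lb ub : CMatrix P n).sem lb ub := by
  rw [CMatrix.mem_sem]
  refine ⟨⟨hv, fun c hc => ?_⟩, fun i j => ?_⟩
  · simp only [CMatrix.initial, Finset.mem_union, Finset.mem_image, Finset.mem_univ,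
      true_and] at hc
    rcases hc with ⟨p, rfl⟩ | ⟨p, rfl⟩ <;>
      simp [Constraint.Sat, AffExpr.eval_ofParam, AffExpr.eval_ofInt, hv p]
  · rw [CMatrix.vals_initial]
    have h : ∀ i : Fin (n + 1), ClockVal.val (fun _ => 0 : ClockVal n) i = 0 := by
      intro i
      induction i using Fin.cases <;> simp
    simp [h]

end Forward

/-! ### From concrete runs to abstract runs -/

section Completeness

variable {L P : Type*} [Fintype P] {n : ℕ} {lb ub v : P → ℤ} {A : Automaton L P n}

theorem Automaton.exists_symInit_contains (hv : Bounded lb ub v) {d : ℝ≥0} {s : State L n}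
    (hs : A.DelayStep v d (A.init, fun _ => 0) s) :
    ∃ S ∈ A.SymInit lb ub, S.Contains v s := by
  obtain ⟨h1, h2, h3⟩ := hs
  rw [h1, h2] at h3
  obtain ⟨M, hM, hcp, hη⟩ := CMatrix.exists_mem_applyGuard (A.inv A.init).1 h3
    CMatrix.isCPDBM_initial.up (CMatrix.mem_sem_up (CMatrix.mem_sem_initial hv) d)
  exact ⟨⟨A.init, M.sem lb ub, M, hcp, rfl⟩, ⟨rfl, M, hM, rfl⟩, h1, by rw [h2]; exact hη⟩

/-- Symbolic states collect states after a delay, so one symbolic step matches an action and the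
delay after it. The invariant on entry is not consulted. -/
theorem Automaton.exists_symStep_contains {S : SymState L n lb ub} {s m t : State L n} {d : ℝ≥0}
    (hS : S.Contains v s) (ha : A.ActStep v s m) (hd : A.DelayStep v d m t) :
    ∃ T, A.SymStep S T ∧ T.Contains v t := by
  obtain ⟨hl, hs⟩ := hS
  obtain ⟨g, R, htr, hg, hm, -⟩ := ha
  obtain ⟨hd1, hd2, hd3⟩ := hd
  obtain ⟨M, hM, hZ⟩ := S.isZone
  rw [hZ] at hs
  obtain ⟨M₁, hM₁, c₁, s₁⟩ := CMatrix.exists_mem_applyGuard g.1 hg hM hs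
  obtain ⟨M₂, hM₂, c₂, s₂⟩ := CMatrix.exists_mem_canon c₁ s₁
  obtain ⟨M₃, hM₃, c₃, s₃⟩ := CMatrix.exists_mem_applyGuard (A.inv t.1).1
    (by rw [hd2, hm] at hd3; exact hd3) (c₂.reset R).up
    (CMatrix.mem_sem_up (CMatrix.mem_sem_reset s₂ R) d)
  obtain ⟨M₄, hM₄, c₄, s₄⟩ := CMatrix.exists_mem_canon c₃ s₃
  refine ⟨⟨t.1, M₄.sem lb ub, M₄, c₄, rfl⟩, ⟨M, hM, hZ, g, R, ?_, M₁, hM₁, M₂, hM₂, M₃, hM₃,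
    M₄, hM₄, rfl⟩, rfl, ?_⟩
  · rw [hl, ← hd1] at htr
    exact htr
  · rw [hd2, hm]
    exact s₄

theorem Automaton.IsAbstraction.exists_contains {α : SymState L n lb ub → Set (SymState L n lb ub)}
    (hα : A.IsAbstraction α) {S : SymState L n lb ub} {s : State L n} (hs : S.Contains v s) :
    ∃ Q ∈ α S, Q.Contains v s := by
  obtain ⟨Q, hQ, hvQ⟩ := hα.covers S v ⟨_, hs.2⟩
  exact ⟨Q, hQ, hs.1.trans (hα.loc_eq S Q hQ).symm, hα.zone_subset S Q hQ v hvQ _ hs.2⟩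

/-- Abstract runs follow the concrete ones. -/
theorem Automaton.HasAcceptingRun.hasAbsAcceptingRun
    {α : SymState L n lb ub → Set (SymState L n lb ub)} (hα : A.IsAbstraction α)
    (hv : Bounded lb ub v) (h : A.HasAcceptingRun v) : A.HasAbsAcceptingRun α v := by
  obtain ⟨s, s', d, hr, hacc⟩ := h
  have h0 : ∃ Q ∈ A.AbsInit α, Q.Contains v (s' 0) := by
    obtain ⟨S, hS, hc⟩ := A.exists_symInit_contains (lb := lb) (ub := ub) hv
      (hr.start ▸ hr.delay 0)
    obtain ⟨Q, hQ, hc⟩ := hα.exists_contains hc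
    exact ⟨Q, ⟨S, hS, hQ⟩, hc⟩
  have hstep : ∀ (i : ℕ) (Q : SymState L n lb ub), Q.Contains v (s' i) →
      ∃ Q', A.AbsStep α Q Q' ∧ Q'.Contains v (s' (i + 1)) := by
    intro i Q hQ
    obtain ⟨S, hS, hc⟩ := A.exists_symStep_contains hQ (hr.action i) (hr.delay (i + 1))
    obtain ⟨Q', hQ', hc⟩ := hα.exists_contains hc
    exact ⟨Q', ⟨S, hS, hQ'⟩, hc⟩
  obtain ⟨Q₀, hQ₀, hc₀⟩ := h0
  choose f hf hfc using hstep
  let F : (i : ℕ) → {Q : SymState L n lb ub // Q.Contains v (s' i)} := fun i =>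
    Nat.rec ⟨Q₀, hc₀⟩ (fun i Q => ⟨f i Q.1 Q.2, hfc i Q.1 Q.2⟩) i
  refine ⟨fun i => (F i).1, hQ₀, fun i => hf i (F i).1 (F i).2, fun i => ⟨_, (F i).2.2⟩, ?_⟩
  -- `F i` contains `s' i`, which has the location of `s i`.
  convert hacc using 3 with i
  rw [← (F i).2.1, (hr.delay i).1]

end Completeness

/-! ### Canonisation, and undoing resets and delays -/

section Backward

variable {P : Type*} [Fintype P] {n : ℕ} {lb ub v : P → ℤ}

theorem CMatrix.sem_subset_of_mem_apply {M M' : CMatrix P n} {i j : Fin (n + 1)} {b : Bound P}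
    (h : M' ∈ M.apply lb ub i j b) {η : ClockVal n} (hη : (v, η) ∈ M'.sem lb ub) :
    (v, η) ∈ M.sem lb ub ∧ b.Holds v (η.val i - η.val j) := by
  rw [CMatrix.mem_sem] at hη
  obtain ⟨hv, hvals⟩ := CMatrix.vals_of_mem_apply h hη.1
  refine ⟨CMatrix.mem_sem.2 ⟨hv, fun k l => ?_⟩, ?_⟩
  · have := hη.2 k l
    rw [hvals] at this
    split_ifs at this with hkl
    · obtain ⟨rfl, rfl⟩ := hkl; exact this.1
    · exact this
  · have := hη.2 i j
    rw [hvals, if_pos ⟨rfl, rfl⟩] at this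
    exact this.2

theorem CMatrix.sem_subset_of_mem_applyGuard {g : Guard P n} {M M' : CMatrix P n}
    (h : M' ∈ CMatrix.applyGuard lb ub g M) {η : ClockVal n} (hη : (v, η) ∈ M'.sem lb ub) :
    (v, η) ∈ M.sem lb ub ∧ g.Sat v η := by
  induction g generalizing M with
  | nil =>
    obtain rfl : M' = M := h
    exact ⟨hη, by simp [Guard.Sat]⟩
  | cons a g ih =>
    obtain ⟨M₁, h1, h2⟩ := h
    obtain ⟨h3, h4⟩ := ih h2
    obtain ⟨h5, h6⟩ := CMatrix.sem_subset_of_mem_apply h1 h3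
    exact ⟨h5, by simpa [Guard.Sat] using ⟨h6, h4⟩⟩

theorem CMatrix.sem_subset_of_mem_canon {M M' : CMatrix P n} (h : M' ∈ M.canon lb ub)
    {η : ClockVal n} (hη : (v, η) ∈ M'.sem lb ub) : (v, η) ∈ M.sem lb ub := by
  have key : ∀ s s' : ℕ × ℕ × ℕ × CMatrix P n, Relation.ReflTransGen (FWStep lb ub) s s' →
      (v, η) ∈ s'.2.2.2.sem lb ub → (v, η) ∈ s.2.2.2.sem lb ub := by
    intro s s' h
    induction h with
    | refl => exact id
    | tail _ hstep ih =>
      intro h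
      apply ih
      cases hstep with
      | relax k i j M M' h' => exact (CMatrix.sem_subset_of_mem_apply h' h).1
      | nextRow k i M => exact h
      | nextPivot k M => exact h
  exact key _ _ h hη

/-- The relation between the sets `H` at the beginning of the round with pivot `k` and the sets `W`
when the entry `(i, j)` is about to be processed. -/
structure PartialRound (k i j : ℕ) (H W : Fin (n + 1) → Fin (n + 1) → Set ℝ) : Prop where
  lower : ∀ a b, IsLowerSet (H a b)
  diag : ∀ a, (0 : ℝ) ∈ H a a
  triangle : ∀ a m b : Fin (n + 1), (m : ℕ) < k → H a b ⊆ H a m + H m b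
  entries : ∀ a b : Fin (n + 1), W a b =
    if (a : ℕ) < i ∨ (a : ℕ) = i ∧ (b : ℕ) < j then
      {r ∈ H a b | ∀ κ : Fin (n + 1), (κ : ℕ) = k → r ∈ H a κ + H κ b} else H a b

/-- As `0 ∈ H k k`, the detour through `k` does not tighten an entry of the pivot column, nor of the
pivot row. So the in-place loop reads the values from the start of the round. -/
theorem PartialRound.col_pivot {i j : ℕ} {H W : Fin (n + 1) → Fin (n + 1) → Set ℝ}
    {k : Fin (n + 1)} (h : PartialRound k i j H W) (a : Fin (n + 1)) : W a k = H a k := by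
  rw [h.entries]
  split_ifs
  · refine Set.Subset.antisymm (fun r hr => hr.1) fun r hr => ⟨hr, fun κ hκ => ?_⟩
    obtain rfl := Fin.ext hκ
    exact ⟨r, hr, 0, h.diag _, add_zero r⟩
  · rfl

theorem PartialRound.row_pivot {i j : ℕ} {H W : Fin (n + 1) → Fin (n + 1) → Set ℝ}
    {k : Fin (n + 1)} (h : PartialRound k i j H W) (b : Fin (n + 1)) : W k b = H k b := by
  rw [h.entries]
  split_ifs
  · refine Set.Subset.antisymm (fun r hr => hr.1) fun r hr => ⟨hr, fun κ hκ => ?_⟩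
    obtain rfl := Fin.ext hκ
    exact ⟨0, h.diag _, r, hr, zero_add r⟩
  · rfl

theorem PartialRound.relax {H W W' : Fin (n + 1) → Fin (n + 1) → Set ℝ}
    {k i j : Fin (n + 1)} (h : PartialRound k i j H W)
    (hW' : ∀ a b, W' a b = if a = i ∧ b = j then W i j ∩ (W i k + W k j) else W a b) :
    PartialRound k i (j + 1) H W' := by
  refine ⟨h.lower, h.diag, h.triangle, fun a b => ?_⟩
  rw [hW', h.col_pivot, h.row_pivot]
  by_cases hab : a = i ∧ b = j
  · obtain ⟨rfl, rfl⟩ := hab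
    rw [if_pos ⟨rfl, rfl⟩, if_pos (by omega), h.entries, if_neg (by omega)]
    ext r
    refine and_congr_right fun _ => ⟨fun hr κ hκ => ?_, fun hr => hr k rfl⟩
    obtain rfl := Fin.ext hκ
    exact hr
  · rw [if_neg hab, h.entries]
    refine if_congr ?_ rfl rfl
    rw [Fin.ext_iff, Fin.ext_iff] at hab
    omega

theorem PartialRound.nextRow {H W : Fin (n + 1) → Fin (n + 1) → Set ℝ}
    {k i : ℕ} (h : PartialRound k i (n + 1) H W) : PartialRound k (i + 1) 0 H W := by
  refine ⟨h.lower, h.diag, h.triangle, fun a b => ?_⟩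
  rw [h.entries]
  refine if_congr ?_ rfl rfl
  omega

/-- After the round each entry is the smaller of the direct set and the detour through `k`. For an
intermediate `m < k`, the cases are which of the two legs makes the detour; for `m = k` the claim is
the relaxation itself. -/
theorem PartialRound.nextPivot {H W : Fin (n + 1) → Fin (n + 1) → Set ℝ} {k : Fin (n + 1)}
    (h : PartialRound k (n + 1) 0 H W) (hlow : ∀ a b, IsLowerSet (W a b))
    (hdiag : ∀ a, (0 : ℝ) ∈ W a a) : PartialRound (k + 1) 0 0 W W := by
  refine ⟨hlow, hdiag, fun a m b hm => ?_, fun a b => (if_neg (by omega)).symm⟩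
  have hW : ∀ a b, W a b = H a b ∩ (H a k + H k b) := by
    intro a b
    rw [h.entries, if_pos (by omega)]
    ext r
    refine and_congr_right fun _ => ⟨fun hr => hr k rfl, fun hr κ hκ => ?_⟩
    obtain rfl := Fin.ext hκ
    exact hr
  have hcases : ∀ a b, W a b = H a b ∨ W a b = H a k + H k b := by
    intro a b
    rw [hW]
    rcases (h.lower a b).total ((h.lower k b).add_left (s := H a k)) with h' | h'
    · exact Or.inl (Set.inter_eq_left.2 h')
    · exact Or.inr (Set.inter_eq_right.2 h')
  rcases Nat.lt_succ_iff_lt_or_eq.1 hm with hm | hm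
  · have hab : W a b ⊆ H a k + H k b := by rw [hW]; exact Set.inter_subset_right
    rcases hcases a m with h1 | h1 <;> rcases hcases m b with h2 | h2 <;> rw [h1, h2]
    · rw [hW]
      exact Set.inter_subset_left.trans (h.triangle a m b hm)
    · rw [← add_assoc]
      exact hab.trans (Set.add_subset_add_right (h.triangle a m k hm))
    · rw [add_assoc]
      exact hab.trans (Set.add_subset_add_left (h.triangle k m b hm))
    · refine hab.trans fun r hr => ?_
      -- Both legs pass through `k`: the cycle `k → m → k` is not negative and can be cut out.
      have h0 := h.triangle k m k hm (h.diag k)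
      rw [show H a k + H k m + (H m k + H k b) = H a k + (H k m + H m k) + H k b by
        simp only [add_assoc]]
      refine Set.add_subset_add_right ?_ hr
      exact fun x hx => ⟨x, hx, 0, h0, add_zero x⟩
  · obtain rfl := Fin.ext hm
    rw [h.col_pivot, h.row_pivot, hW]
    exact Set.inter_subset_right

/-- Canonisation only tightens the bounds, and it establishes the triangle inequality unless it
detects a negative cycle. -/
theorem CMatrix.triangle_of_mem_canon {M M' : CMatrix P n} (h : M' ∈ M.canon lb ub)
    (hv : v ∈ csem lb ub M'.C) (hdiag : ∀ a, (0 : ℝ) ∈ M'.vals v a a) :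
    v ∈ csem lb ub M.C ∧ (∀ a b, M'.vals v a b ⊆ M.vals v a b) ∧
      ∀ a m b, M'.vals v a b ⊆ M'.vals v a m + M'.vals v m b := by
  have key : ∀ s : ℕ × ℕ × ℕ × CMatrix P n, Relation.ReflTransGen (FWStep lb ub) (0, 0, 0, M) s →
      v ∈ csem lb ub s.2.2.2.C → (∀ a, (0 : ℝ) ∈ s.2.2.2.vals v a a) →
      (v ∈ csem lb ub M.C ∧ (∀ a b, s.2.2.2.vals v a b ⊆ M.vals v a b)) ∧
        ∃ H, PartialRound s.1 s.2.1 s.2.2.1 H (s.2.2.2.vals v) := by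
    intro s hs
    induction hs with
    | refl =>
      exact fun hv hd => ⟨⟨hv, fun a b => subset_rfl⟩, M.vals v, M.isLowerSet_vals v, hd,
        fun a m b h => absurd h (Nat.not_lt_zero _), fun a b => (if_neg (by simp)).symm⟩
    | tail _ hstep ih =>
      intro hv hd
      cases hstep with
      | relax k i j N N' h' =>
        obtain ⟨hvN, hvals⟩ := CMatrix.vals_of_mem_apply h' hv
        have hsub : ∀ a b, N'.vals v a b ⊆ N.vals v a b := by
          intro a b
          rw [hvals]
          split_ifs with hab
          · rw [hab.1, hab.2]; exact Set.inter_subset_left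
          · exact subset_rfl
        -- Entries only shrink, so 0 on the final diagonal was there at every earlier stage.
        obtain ⟨⟨h1, h2⟩, H, hH⟩ := ih hvN fun a => hsub a a (hd a)
        refine ⟨⟨h1, fun a b => (hsub a b).trans (h2 a b)⟩, H, hH.relax fun a b => ?_⟩
        rw [hvals, Bound.vals_comp]
        rfl
      | nextRow k i N =>
        obtain ⟨h1, H, hH⟩ := ih hv hd
        exact ⟨h1, H, hH.nextRow⟩
      | nextPivot k N =>
        obtain ⟨h1, H, hH⟩ := ih hv hd
        exact ⟨h1, _, hH.nextPivot (N.isLowerSet_vals v) hd⟩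
  obtain ⟨⟨h1, h2⟩, H, hH⟩ := key _ h hv hdiag
  refine ⟨h1, h2, fun a m b => ?_⟩
  -- At counter `(n + 1, 0, 0)` no entry of the new round is processed, and every index has been a
  -- pivot.
  have : M'.vals v = H := by
    funext a b
    rw [hH.entries, if_neg (by dsimp only; omega)]
  rw [this]
  exact hH.triangle a m b m.2

/-- A family of sets of differences that is closed under composition. -/
structure IsClosedFamily (H : Fin (n + 1) → Fin (n + 1) → Set ℝ) : Prop where
  lower : ∀ a b, IsLowerSet (H a b)
  diag : ∀ a, H a a = Set.Iic 0
  nonneg : ∀ a, H 0 a ⊆ Set.Iic 0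
  triangle : ∀ a m b, H a b ⊆ H a m + H m b

/-- One-dimensional Helly property: a solution for all clocks but one extends to that clock. -/
theorem IsClosedFamily.exists_extension {H : Fin (n + 1) → Fin (n + 1) → Set ℝ}
    (hH : IsClosedFamily H) (r : Fin (n + 1)) (x : Fin (n + 1) → ℝ)
    (hx : ∀ i j, i ≠ r → j ≠ r → x i - x j ∈ H i j) :
    ∃ y, ∀ i, i ≠ r → y - x i ∈ H r i ∧ x i - y ∈ H i r := by
  rcases isEmpty_or_nonempty {i : Fin (n + 1) // i ≠ r} with he | hne
  · exact ⟨0, fun i hi => (he.false ⟨i, hi⟩).elim⟩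
  -- A finite chain of sets has a least member; it is used for the tightest upper and the tightest
  -- lower bound on `y`.
  have min : ∀ f : {i : Fin (n + 1) // i ≠ r} → Set ℝ, (∀ i j, f i ⊆ f j ∨ f j ⊆ f i) →
      ∃ i, ∀ j, f i ⊆ f j := by
    intro f hf
    have hdir : Directed (fun s t : Set ℝ => t ⊆ s) f := by
      intro i j
      rcases hf i j with h | h
      · exact ⟨i, subset_rfl, h⟩
      · exact ⟨j, h, subset_rfl⟩
    have : IsTrans (Set ℝ) (fun s t : Set ℝ => t ⊆ s) := ⟨fun a b c h1 h2 => h2.trans h1⟩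
    obtain ⟨z, hz⟩ := hdir.finite_le id
    exact ⟨z, hz⟩
  obtain ⟨a, ha⟩ := min (fun i => {y | y - x i ∈ H r i}) (by
    refine fun i j => IsLowerSet.total (α := ℝ) ?_ ?_
    · exact fun y z hzy hy => hH.lower r i (sub_le_sub_right hzy _) hy
    · exact fun y z hzy hy => hH.lower r j (sub_le_sub_right hzy _) hy)
  obtain ⟨b, hb⟩ := min (fun i => {y | x i - y ∈ H i r}) (by
    refine fun i j => IsUpperSet.total (α := ℝ) ?_ ?_
    · exact fun y z hzy hy => hH.lower i r (sub_le_sub_left hzy _) hy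
    · exact fun y z hzy hy => hH.lower j r (sub_le_sub_left hzy _) hy)
  -- The triangle inequality through `r` makes the two tightest bounds compatible: `x b - x a`
  -- splits as `(x b - y) + (y - x a)`.
  obtain ⟨s, hs, t, ht, hst⟩ := hH.triangle b r a (hx b a b.2 a.2)
  have hst' : s + t = x b - x a := hst
  refine ⟨x b - s, fun i hi => ⟨ha ⟨i, hi⟩ ?_, hb ⟨i, hi⟩ ?_⟩⟩
  · show x b - s - x a ∈ H r a
    rwa [show x b - s - x a = t by linarith]
  · show x b - (x b - s) ∈ H b r
    rwa [sub_sub_cancel]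

/-- A reset pulls the family back along the map sending `r` to 0. On the diagonal, which a reset
leaves alone, this holds because all diagonal entries agree. Closedness under resets is then
immediate. -/
theorem IsClosedFamily.vals_resetClock {M : CMatrix P n} (hM : IsClosedFamily (M.vals v))
    (r i j : Fin (n + 1)) : (M.resetClock r).vals v i j =
      M.vals v (if i = r then 0 else i) (if j = r then 0 else j) := by
  by_cases hij : i = j
  · subst hij
    rw [hM.diag]
    simpa [CMatrix.vals, CMatrix.resetClock] using hM.diag i
  · by_cases hi : i = r
    · have hj : j ≠ r := fun h => hij (hi.trans h.symm)
      simp [CMatrix.vals, CMatrix.resetClock, hi, hj, hj.symm]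
    · by_cases hj : j = r <;> simp [CMatrix.vals, CMatrix.resetClock, hi, hj]

theorem IsClosedFamily.resetClock {M : CMatrix P n} (hM : IsClosedFamily (M.vals v))
    (r : Fin (n + 1)) : IsClosedFamily ((M.resetClock r).vals v) := by
  have h0 : (if (0 : Fin (n + 1)) = r then 0 else (0 : Fin (n + 1))) = 0 := ite_self 0
  refine ⟨fun a b => CMatrix.isLowerSet_vals _ _ _ _, fun a => ?_, fun a => ?_, fun a m b => ?_⟩
  · rw [hM.vals_resetClock]; exact hM.diag _
  · rw [hM.vals_resetClock, h0]; exact hM.nonneg _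
  · simp only [hM.vals_resetClock]; exact hM.triangle _ _ _

theorem IsClosedFamily.exists_of_mem_sem_resetClock {M : CMatrix P n}
    (hM : IsClosedFamily (M.vals v)) {r : Fin (n + 1)} {η' : ClockVal n}
    (hη' : (v, η') ∈ (M.resetClock r).sem lb ub) :
    ∃ η, (v, η) ∈ M.sem lb ub ∧ η.reset {r} = η' := by
  rw [CMatrix.mem_sem] at hη'
  obtain ⟨hv, hη'⟩ := hη'
  simp only [hM.vals_resetClock] at hη'
  by_cases hr : r = 0
  · subst hr
    refine ⟨η', CMatrix.mem_sem.2 ⟨hv, fun i j => ?_⟩, ?_⟩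
    · have := hη' i j
      rwa [show (if i = 0 then 0 else i) = i by split_ifs with h <;> simp [h],
        show (if j = 0 then 0 else j) = j by split_ifs with h <;> simp [h]] at this
    · refine ClockVal.ext_val fun i hi => ?_
      simp [ClockVal.val_reset, hi]
  · have h0r : (0 : Fin (n + 1)) ≠ r := fun h => hr h.symm
    -- `y` is the value of clock `r` before the reset; the entry `(0, r)` makes it non-negative.
    obtain ⟨y, hy⟩ := hM.exists_extension r η'.val fun i j hi hj => by
      simpa [hi, hj] using hη' i j
    have hy0 : 0 ≤ y := by
      have := hM.nonneg r (hy 0 h0r).2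
      simpa using this
    have hr0 : η'.val r = 0 := by
      have := hη' r 0
      rw [if_pos rfl, if_neg h0r, hM.diag] at this
      exact le_antisymm (by simpa using this) (η'.val_nonneg r)
    lift y to ℝ≥0 using hy0
    let η : ClockVal n := fun k => if k.succ = r then y else η' k
    have hval : ∀ i, η.val i = if i = r then (y : ℝ) else η'.val i := by
      intro i
      induction i using Fin.cases with
      | zero => rw [if_neg h0r]; rfl
      | succ k =>
        rw [ClockVal.val_succ]
        by_cases hk : k.succ = r
        · simp only [η, if_pos hk]
        · simp only [η, if_neg hk, ClockVal.val_succ]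
    refine ⟨η, CMatrix.mem_sem.2 ⟨hv, fun i j => ?_⟩, ClockVal.ext_val fun i hi => ?_⟩
    · rw [hval, hval]
      by_cases hi : i = r <;> by_cases hj : j = r
      · subst hi; subst hj; simp [hM.diag]
      · rw [if_pos hi, if_neg hj, hi]; exact (hy j hj).1
      · rw [if_neg hi, if_pos hj, hj]; exact (hy i hi).2
      · rw [if_neg hi, if_neg hj]; simpa [hi, hj] using hη' i j
    · rw [ClockVal.val_reset, hval]
      by_cases hi : i = r
      · simp [hi, hr0]
      · simp [hi]

theorem IsClosedFamily.reset {M : CMatrix P n} (hM : IsClosedFamily (M.vals v))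
    (R : Finset (Fin (n + 1))) : IsClosedFamily ((M.reset R).vals v) := by
  unfold CMatrix.reset
  generalize R.sort (· ≤ ·) = l
  induction l generalizing M with
  | nil => exact hM
  | cons r l ih => exact ih (hM.resetClock r)

theorem IsClosedFamily.exists_of_mem_sem_reset {M : CMatrix P n}
    (hM : IsClosedFamily (M.vals v)) {R : Finset (Fin (n + 1))} {η' : ClockVal n}
    (hη' : (v, η') ∈ (M.reset R).sem lb ub) :
    ∃ η, (v, η) ∈ M.sem lb ub ∧ η.reset R = η' := by
  have key : ∀ (l : List (Fin (n + 1))) (M : CMatrix P n), IsClosedFamily (M.vals v) →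
      ∀ η', (v, η') ∈ (l.foldl CMatrix.resetClock M).sem lb ub →
      ∃ η, (v, η) ∈ M.sem lb ub ∧ η.reset l.toFinset = η' := by
    intro l
    induction l with
    | nil => exact fun M _ η' h => ⟨η', h, by rw [List.toFinset_nil, ClockVal.reset_empty]⟩
    | cons r l ih =>
      intro M hM η' h
      obtain ⟨η₁, h1, rfl⟩ := ih _ (hM.resetClock r) η' h
      obtain ⟨η, h2, rfl⟩ := hM.exists_of_mem_sem_resetClock h1
      exact ⟨η, h2, by rw [List.toFinset_cons, ClockVal.reset_insert]⟩
  simpa only [Finset.sort_toFinset] using key (R.sort (· ≤ ·)) M hM η' hη'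

/-- The forgotten clock is now the zero clock: extending to index 0 gives a position `y` of the
origin on the time line, and subtracting it undoes the delay. -/
theorem IsClosedFamily.exists_of_mem_sem_up {M : CMatrix P n}
    (hM : IsClosedFamily (M.vals v)) {η' : ClockVal n} (hη' : (v, η') ∈ M.up.sem lb ub) :
    ∃ (η : ClockVal n) (d : ℝ≥0), (v, η) ∈ M.sem lb ub ∧ η' = η.delay d := by
  rw [CMatrix.mem_sem] at hη'
  obtain ⟨hv, hη'⟩ := hη'
  simp only [CMatrix.vals_up] at hη'
  obtain ⟨y, hy⟩ := hM.exists_extension 0 η'.val fun i j hi hj => by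
    simpa [hi, hj] using hη' i j
  have h0 : ∀ i, 0 - η'.val i ∈ M.vals v 0 i := fun i => by simpa using hη' 0 i
  -- `y` may be negative, while delays may not. Cutting it off at 0 is harmless: the entries `(0,
  -- i)` survive `up`, and raising `y` only lowers `η' i - y`.
  have hz : ∀ i, i ≠ 0 → max y 0 - η'.val i ∈ M.vals v 0 i ∧ η'.val i - max y 0 ∈ M.vals v i 0 := by
    intro i hi
    constructor
    · rcases max_choice y 0 with h | h <;> rw [h]
      exacts [(hy i hi).1, h0 i]
    · exact M.isLowerSet_vals v i 0 (sub_le_sub_left (le_max_left y 0) _) (hy i hi).2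
  have hle : ∀ i, i ≠ 0 → max y 0 ≤ η'.val i := fun i hi => by
    simpa using hM.nonneg i (hz i hi).1
  let d : ℝ≥0 := ⟨max y 0, le_max_right y 0⟩
  have hd : (d : ℝ) = max y 0 := rfl
  let η : ClockVal n := fun k => ⟨η' k - d, sub_nonneg.2 (hle k.succ (Fin.succ_ne_zero k))⟩
  have hval : ∀ i, i ≠ 0 → η.val i = η'.val i - max y 0 := by
    intro i hi
    obtain ⟨k, rfl⟩ := Fin.exists_succ_eq.2 hi
    rfl
  refine ⟨η, d, CMatrix.mem_sem.2 ⟨hv, fun i j => ?_⟩, ClockVal.ext_val fun i hi => ?_⟩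
  · by_cases hi : i = 0 <;> by_cases hj : j = 0
    · subst hi; subst hj; simp [hM.diag]
    · rw [hval j hj, hi, ClockVal.val_zero, zero_sub, neg_sub]
      exact (hz j hj).1
    · rw [hval i hi, hj, ClockVal.val_zero, sub_zero]
      exact (hz i hi).2
    · rw [hval i hi, hval j hj, sub_sub_sub_cancel_right]
      simpa [hi, hj] using hη' i j
  · rw [ClockVal.val_delay _ _ hi, hval i hi, hd]
    ring

end Backward

/-! ### Concrete predecessors of symbolic steps -/

section Soundness

variable {L P : Type*} [Fintype P] {n : ℕ} {lb ub v : P → ℤ} {A : Automaton L P n}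

theorem CMatrix.IsCPDBM.vals_diag_subset {M : CMatrix P n} (hM : M.IsCPDBM lb ub)
    (i : Fin (n + 1)) : M.vals v i i ⊆ Set.Iic 0 := by
  intro r hr
  have := hr 0 (hM.1 i)
  rw [AffExpr.eval_zero, Int.cast_zero] at this
  split_ifs at this
  exacts [this, this.le]

theorem CMatrix.IsCPDBM.vals_zero_subset {M : CMatrix P n} (hM : M.IsCPDBM lb ub)
    (hv : v ∈ csem lb ub M.C) (i : Fin (n + 1)) : M.vals v 0 i ⊆ Set.Iic 0 := by
  intro r hr
  obtain ⟨e, he, he0⟩ := hM.2 i v hv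
  have := hr e he
  have h0 : (e.eval v : ℝ) ≤ 0 := by exact_mod_cast he0
  split_ifs at this
  exacts [le_trans this h0, le_trans (le_of_lt this) h0]

theorem CMatrix.vals_resetClock_diag (M : CMatrix P n) (r i : Fin (n + 1)) :
    (M.resetClock r).vals v i i = M.vals v i i := by
  simp [CMatrix.vals, CMatrix.resetClock]

theorem CMatrix.vals_reset_diag (M : CMatrix P n) (R : Finset (Fin (n + 1))) (i : Fin (n + 1)) :
    (M.reset R).vals v i i = M.vals v i i := by
  unfold CMatrix.reset
  generalize R.sort (· ≤ ·) = l
  induction l generalizing M with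
  | nil => rfl
  | cons r l ih => exact (ih _).trans (M.vals_resetClock_diag r i)

theorem CMatrix.reset_C {P : Type*} (M : CMatrix P n) (R : Finset (Fin (n + 1))) :
    (M.reset R).C = M.C := by
  unfold CMatrix.reset
  generalize R.sort (· ≤ ·) = l
  induction l generalizing M with
  | nil => rfl
  | cons r l ih => exact ih _

theorem CMatrix.vals_subset_of_mem_applyGuard {g : Guard P n} {M M' : CMatrix P n}
    (h : M' ∈ CMatrix.applyGuard lb ub g M) (hv : v ∈ csem lb ub M'.C) :
    v ∈ csem lb ub M.C ∧ ∀ i j, M'.vals v i j ⊆ M.vals v i j := by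
  induction g generalizing M with
  | nil =>
    obtain rfl : M' = M := h
    exact ⟨hv, fun _ _ => subset_rfl⟩
  | cons a g ih =>
    obtain ⟨M₁, h1, h2⟩ := h
    obtain ⟨h3, h4⟩ := ih h2
    obtain ⟨h5, h6⟩ := CMatrix.vals_of_mem_apply h1 h3
    refine ⟨h5, fun i j => (h4 i j).trans ?_⟩
    rw [h6]
    split_ifs with hij
    · rw [hij.1, hij.2]; exact Set.inter_subset_left
    · exact subset_rfl

/-- The initial matrix has all entries `Iic 0`; this family is closed and its only solution is the
zero valuation. -/
theorem Automaton.exists_delayStep_of_symInit {S : SymState L n lb ub} (hS : S ∈ A.SymInit lb ub)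
    {s : State L n} (hs : S.Contains v s) : ∃ d, A.DelayStep v d (A.init, fun _ => 0) s := by
  obtain ⟨hl, M, hM, hZ⟩ := hS
  obtain ⟨h1, h2⟩ := hs
  rw [hZ] at h2
  obtain ⟨h3, h4⟩ := CMatrix.sem_subset_of_mem_applyGuard hM h2
  have hcl : IsClosedFamily ((CMatrix.initial lb ub : CMatrix P n).vals v) := by
    simp only [show (CMatrix.initial lb ub : CMatrix P n).vals v = fun _ _ => Set.Iic 0 from
      funext₂ CMatrix.vals_initial]
    exact ⟨fun _ _ => isLowerSet_Iic _, fun _ => rfl, fun _ => subset_rfl,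
      fun _ _ _ r hr => ⟨r, hr, 0, Set.mem_Iic.2 le_rfl, add_zero r⟩⟩
  obtain ⟨η, d, h5, h6⟩ := hcl.exists_of_mem_sem_up h3
  have h7 : η = fun _ => 0 := by
    refine ClockVal.ext_val fun i hi => ?_
    have := (CMatrix.mem_sem.1 h5).2 i 0
    rw [CMatrix.vals_initial] at this
    have h8 : η.val i ≤ 0 := by simpa using this
    obtain ⟨k, rfl⟩ := Fin.exists_succ_eq.2 hi
    rw [le_antisymm h8 (η.val_nonneg _)]
    simp
  subst h7
  refine ⟨d, h1.trans hl, h6, ?_⟩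
  rw [h1, hl]
  exact h4

theorem Automaton.exists_step_of_symStep (hA : A.InvariantsHoldOnEntry v)
    {S T : SymState L n lb ub} (hST : A.SymStep S T) {t : State L n} (ht : T.Contains v t) :
    ∃ s m d, S.Contains v s ∧ A.ActStep v s m ∧ A.DelayStep v d m t := by
  obtain ⟨M, hM, hZ, g, R, htr, M₁, hM₁, M₂, hM₂, M₃, hM₃, M₄, hM₄, hZ'⟩ := hST
  obtain ⟨hl, ht⟩ := ht
  rw [hZ'] at ht
  obtain ⟨h1, h2⟩ := CMatrix.sem_subset_of_mem_applyGuard hM₃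
    (CMatrix.sem_subset_of_mem_canon hM₄ ht)
  have hv₂ : v ∈ csem lb ub M₂.C := by
    have := (CMatrix.mem_sem.1 h1).1
    rw [← CMatrix.reset_C M₂ R]
    exact this
  -- Resets and `up` keep the diagonal, so a point of the later zone rules out negative cycles in
  -- `M₂`.
  have hd : ∀ a, (0 : ℝ) ∈ M₂.vals v a a := by
    intro a
    have := (CMatrix.mem_sem.1 h1).2 a a
    rwa [sub_self, CMatrix.vals_up, if_neg (by rintro ⟨h, rfl⟩; exact h rfl),
      CMatrix.vals_reset_diag] at this
  obtain ⟨hv₁, hsub₁, htri⟩ := CMatrix.triangle_of_mem_canon hM₂ hv₂ hd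
  obtain ⟨hv, hsub⟩ := CMatrix.vals_subset_of_mem_applyGuard hM₁ hv₁
  have hcl : IsClosedFamily (M₂.vals v) := by
    refine ⟨M₂.isLowerSet_vals v, fun a => Set.Subset.antisymm ?_ ?_, fun a => ?_, htri⟩
    · exact ((hsub₁ a a).trans (hsub a a)).trans (hM.vals_diag_subset a)
    · exact fun r hr => M₂.isLowerSet_vals v a a hr (hd a)
    · exact ((hsub₁ 0 a).trans (hsub 0 a)).trans (hM.vals_zero_subset hv a)
  obtain ⟨η', d, h3, h4⟩ := (hcl.reset R).exists_of_mem_sem_up h1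
  obtain ⟨η, h5, rfl⟩ := hcl.exists_of_mem_sem_reset h3
  obtain ⟨h6, h7⟩ := CMatrix.sem_subset_of_mem_applyGuard hM₁
    (CMatrix.sem_subset_of_mem_canon hM₂ h5)
  rw [h4] at h2
  -- The invariant is known only after the delay `d`; `hA` carries it back to the moment of entry.
  refine ⟨(S.loc, η), (T.loc, η.reset R), d, ⟨rfl, by rw [hZ]; exact h6⟩,
    ⟨g, R, htr, h7, rfl, hA _ _ _ _ htr η d h7 h2⟩, hl, h4, ?_⟩
  rw [hl, h4]
  exact h2

end Soundness

/-! ### Time warps and the region argument -/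

section Regions

/-- Strictly monotone maps of the time line that fix zero and commute with the shift by one. -/
structure IsTimeWarp (g : ℝ → ℝ) : Prop where
  strictMono : StrictMono g
  zero : g 0 = 0
  add_one : ∀ x, g (x + 1) = g x + 1

theorem IsTimeWarp.add_natCast {g : ℝ → ℝ} (hg : IsTimeWarp g) (x : ℝ) (m : ℕ) :
    g (x + m) = g x + m := by
  induction m with
  | zero => simp
  | succ m ih => rw [Nat.cast_succ, ← add_assoc, hg.add_one, ih, add_assoc]

/-- Integers are fixed, so warping preserves all comparisons with integer constants, hence with the
values of affine expressions. -/
theorem IsTimeWarp.intCast {g : ℝ → ℝ} (hg : IsTimeWarp g) (z : ℤ) : g z = z := by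
  obtain ⟨m, rfl | rfl⟩ := z.eq_nat_or_neg
  · have := hg.add_natCast 0 m
    simpa [hg.zero] using this
  · have := hg.add_natCast (-m) m
    rw [neg_add_cancel, hg.zero] at this
    push_cast
    linarith

theorem IsTimeWarp.le_intCast_iff {g : ℝ → ℝ} (hg : IsTimeWarp g) (x : ℝ) (z : ℤ) :
    g x ≤ z ↔ x ≤ z := by
  simpa only [hg.intCast] using hg.strictMono.le_iff_le (a := x) (b := (z : ℝ))

theorem IsTimeWarp.lt_intCast_iff {g : ℝ → ℝ} (hg : IsTimeWarp g) (x : ℝ) (z : ℤ) :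
    g x < z ↔ x < z := by
  simpa only [hg.intCast] using hg.strictMono.lt_iff_lt (a := x) (b := (z : ℝ))

theorem IsTimeWarp.intCast_le_iff {g : ℝ → ℝ} (hg : IsTimeWarp g) (x : ℝ) (z : ℤ) :
    z ≤ g x ↔ z ≤ x := by
  simpa only [hg.intCast] using hg.strictMono.le_iff_le (a := (z : ℝ)) (b := x)

theorem IsTimeWarp.intCast_lt_iff {g : ℝ → ℝ} (hg : IsTimeWarp g) (x : ℝ) (z : ℤ) :
    z < g x ↔ z < x := by
  simpa only [hg.intCast] using hg.strictMono.lt_iff_lt (a := (z : ℝ)) (b := x)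

/-- Moving the origin of a time warp. -/
theorem IsTimeWarp.shift {g : ℝ → ℝ} (hg : IsTimeWarp g) (d : ℝ) :
    IsTimeWarp fun x => g (x - d) - g (-d) := by
  refine ⟨fun x y h => sub_lt_sub_right (hg.strictMono (sub_lt_sub_right h d)) _, by simp, ?_⟩
  intro x
  rw [add_sub_right_comm, hg.add_one]
  ring

/-- Order-equivalent finite families in the unit interval are related by a strictly monotone map
that fixes the end points. -/
theorem exists_strictMono_of_finite {ι : Type*} [Finite ι] (u w : ι → ℝ)
    (huw : ∀ i j, u i < u j ↔ w i < w j) :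
    ∃ h : ℝ → ℝ, StrictMono h ∧ ∀ i, h (u i) = w i := by
  rcases isEmpty_or_nonempty ι with he | hne
  · exact ⟨id, strictMono_id, fun i => he.elim i⟩
  have hle : ∀ i j, u i ≤ u j ↔ w i ≤ w j := fun i j => by
    rw [← not_lt, ← not_lt, huw]
  -- `ε` is at most every slope between two points with distinct `u`-values. Subtracting `ε * x`
  -- leaves monotone data on a finite set, which extends to ℝ; adding it back makes the extension
  -- strict.
  obtain ⟨ε, hε, hε'⟩ : ∃ ε : ℝ, 0 < ε ∧ ∀ p : ι × ι, u p.1 < u p.2 →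
      ε * (u p.2 - u p.1) ≤ w p.2 - w p.1 := by
    have hf : ∀ p : ι × ι, ∃ ε : ℝ, 0 < ε ∧ (u p.1 < u p.2 →
        ε * (u p.2 - u p.1) ≤ w p.2 - w p.1) := by
      intro p
      by_cases h : u p.1 < u p.2
      · refine ⟨(w p.2 - w p.1) / (u p.2 - u p.1),
          div_pos (sub_pos.2 ((huw _ _).1 h)) (sub_pos.2 h), fun _ => ?_⟩
        rw [div_mul_cancel₀ _ (sub_pos.2 h).ne']
      · exact ⟨1, one_pos, fun h' => absurd h' h⟩
    choose f hf0 hf using hf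
    obtain ⟨p₀, hp₀⟩ := Finite.exists_min f
    exact ⟨f p₀, hf0 p₀, fun p hp =>
      (mul_le_mul_of_nonneg_right (hp₀ p) (sub_nonneg.2 hp.le)).trans (hf p hp)⟩
  choose! φ hφ using fun (x : ℝ) (hx : x ∈ Set.range u) => hx
  have hw : ∀ i, w (φ (u i)) = w i := fun i => by
    have := hφ (u i) ⟨i, rfl⟩
    exact le_antisymm ((hle _ _).1 this.le) ((hle _ _).1 this.ge)
  have hmono : MonotoneOn (fun x => w (φ x) - ε * x) (Set.range u) := by
    rintro _ ⟨i, rfl⟩ _ ⟨j, rfl⟩ hij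
    simp only [hw]
    rcases hij.lt_or_eq with h | h
    · have := hε' (i, j) h
      simp only [mul_sub] at this
      linarith
    · have := (hle i j).1 h.le
      rw [h]
      linarith
  have hfin : (Set.image (fun x => w (φ x) - ε * x) (Set.range u)).Finite :=
    (Set.finite_range u).image _
  obtain ⟨M, hM, hMeq⟩ := hmono.exists_monotone_extension hfin.bddBelow hfin.bddAbove
  refine ⟨fun x => M x + ε * x, fun x y hxy => ?_, fun i => ?_⟩
  · exact add_lt_add_of_le_of_lt (hM hxy.le) (mul_lt_mul_of_pos_left hxy hε)
  · have := hMeq ⟨i, rfl⟩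
    simp only [hw] at this
    simp only
    rw [← this]
    ring

/-- Adjoin the points 0 (`some none`) and 1 (`none`) so that the interpolating map fixes them, then
continue it periodically by `⌊x⌋ + h (fract x)`. -/
theorem exists_isTimeWarp {ι : Type*} [Finite ι] (u w : ι → ℝ)
    (hu0 : ∀ i, 0 ≤ u i) (hu1 : ∀ i, u i < 1) (hw0 : ∀ i, 0 ≤ w i) (hw1 : ∀ i, w i < 1)
    (hz : ∀ i, 0 < u i ↔ 0 < w i) (huw : ∀ i j, u i < u j ↔ w i < w j) :
    ∃ g, IsTimeWarp g ∧ ∀ i, g (u i) = w i := by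
  obtain ⟨h, hh, hval⟩ := exists_strictMono_of_finite
    (fun o : Option (Option ι) => o.elim 1 fun o => o.elim 0 u)
    (fun o : Option (Option ι) => o.elim 1 fun o => o.elim 0 w) (by
      rintro (_ | _ | i) (_ | _ | j) <;>
        simp [huw, hu1, hw1, hz, (hu1 _).not_gt, (hw1 _).not_gt, (hu0 _).not_gt, (hw0 _).not_gt])
  have h1 : h 1 = 1 := hval none
  have h0 : h 0 = 0 := hval (some none)
  have hfr : ∀ x, 0 ≤ h (Int.fract x) ∧ h (Int.fract x) < 1 := fun x =>
    ⟨h0 ▸ hh.monotone (Int.fract_nonneg x), h1 ▸ hh (Int.fract_lt_one x)⟩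
  refine ⟨fun x => ⌊x⌋ + h (Int.fract x), ⟨fun x y hxy => ?_, by simp [h0], fun x => ?_⟩,
    fun i => ?_⟩
  · rcases (Int.floor_mono hxy.le).lt_or_eq with hlt | heq
    · have : (⌊x⌋ : ℝ) + 1 ≤ ⌊y⌋ := by exact_mod_cast hlt
      have h2 := (hfr x).2
      have h3 := (hfr y).1
      linarith
    · simp only [heq]
      have : Int.fract x < Int.fract y := by
        rw [Int.fract, Int.fract, heq]
        linarith
      have := hh this
      linarith
  · simp only [Int.floor_add_one, Int.fract_add_one, Int.cast_add, Int.cast_one]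
    ring
  · have hf : ⌊u i⌋ = 0 := Int.floor_eq_zero_iff.2 ⟨hu0 i, hu1 i⟩
    have hf' : Int.fract (u i) = u i := Int.fract_eq_self.2 ⟨hu0 i, hu1 i⟩
    simp only [hf, hf', Int.cast_zero, zero_add]
    exact hval (some (some i))

variable {L P : Type*} [Fintype P] {n : ℕ} {v : P → ℤ} {A : Automaton L P n}

/-- Clock valuations that agree up to a time warp, except on clocks above `K`. -/
def RegionRel (K : ℕ) (η η' : ClockVal n) : Prop :=
  ∃ g, IsTimeWarp g ∧ ∀ k, g (η k) = η' k ∨ (K : ℝ) < η k ∧ (K : ℝ) < η' k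

/-- The answer is `d' = -g (-d)`: the warp with its origin moved by `d` sends `η k + d` to `g (η k)
- g (-d)`. Surjectivity of `g` is not needed, since only one direction of simulation is claimed. -/
theorem RegionRel.delay {K : ℕ} {η η' : ClockVal n} (h : RegionRel K η η') (d : ℝ≥0) :
    ∃ d', RegionRel K (η.delay d) (η'.delay d') := by
  obtain ⟨g, hg, hk⟩ := h
  have hd : 0 ≤ -g (-d) := by
    have : g (-d) ≤ g 0 := hg.strictMono.monotone (by simp)
    rw [hg.zero] at this
    linarith
  obtain ⟨d', hd'⟩ : ∃ d' : ℝ≥0, (d' : ℝ) = -g (-d) := ⟨⟨_, hd⟩, rfl⟩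
  refine ⟨d', _, hg.shift d, fun k => ?_⟩
  rcases hk k with h | ⟨h1, h2⟩
  · left
    simp only [ClockVal.delay, NNReal.coe_add, add_sub_cancel_right, h, hd']
    ring
  · right
    simp only [ClockVal.delay, NNReal.coe_add]
    exact ⟨lt_add_of_lt_of_nonneg h1 d.2, lt_add_of_lt_of_nonneg h2 d'.2⟩

theorem RegionRel.reset {K : ℕ} {η η' : ClockVal n} (h : RegionRel K η η')
    (R : Finset (Fin (n + 1))) : RegionRel K (η.reset R) (η'.reset R) := by
  obtain ⟨g, hg, hk⟩ := h
  refine ⟨g, hg, fun k => ?_⟩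
  by_cases hR : k.succ ∈ R
  · left
    simp [ClockVal.reset, hR, hg.zero]
  · simpa [ClockVal.reset, hR] using hk k

/-- A simple conjunct compares at most one proper clock with an integer in `[-K, K]`. Warps respect
such comparisons, and for two values above `K` the outcome is the same. -/
theorem RegionRel.sat {K : ℕ} {η η' : ClockVal n} (h : RegionRel K η η') {g : Guard P n}
    (hg : ∀ a ∈ g, a.i = 0 ∨ a.j = 0) (hK : ∀ a ∈ g, (a.expr.eval v).natAbs ≤ K)
    (hs : g.Sat v η) : g.Sat v η' := by
  obtain ⟨f, hf, hk⟩ := h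
  intro a ha
  have h1 := hs a ha
  have hKa : |a.expr.eval v| ≤ (K : ℤ) := by
    rw [Int.abs_eq_natAbs]; exact_mod_cast hK a ha
  have hK1 : (a.expr.eval v : ℝ) ≤ K := by exact_mod_cast (abs_le.1 hKa).2
  have hK2 : -(K : ℝ) ≤ a.expr.eval v := by exact_mod_cast (abs_le.1 hKa).1
  rw [← Bound.mem_vals, Atom.bound, Bound.vals_coe] at h1 ⊢
  generalize a.expr.eval v = z at *
  have upper : ∀ k, (η k : ℝ) ∈ (if a.nonstrict then Set.Iic (z : ℝ) else Set.Iio (z : ℝ)) →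
      (η' k : ℝ) ∈ (if a.nonstrict then Set.Iic (z : ℝ) else Set.Iio (z : ℝ)) := by
    intro k hm
    rcases hk k with h | ⟨h2, h3⟩
    · rw [← h]
      split_ifs at hm ⊢
      exacts [(hf.le_intCast_iff _ _).2 hm, (hf.lt_intCast_iff _ _).2 hm]
    · split_ifs at hm
      exacts [absurd (Set.mem_Iic.1 hm) (by linarith), absurd (Set.mem_Iio.1 hm) (by linarith)]
  have lower : ∀ k, -(η k : ℝ) ∈ (if a.nonstrict then Set.Iic (z : ℝ) else Set.Iio (z : ℝ)) →
      -(η' k : ℝ) ∈ (if a.nonstrict then Set.Iic (z : ℝ) else Set.Iio (z : ℝ)) := by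
    intro k hm
    rcases hk k with h | ⟨h2, h3⟩
    · rw [← h]
      have e1 := hf.intCast_le_iff (η k) (-z)
      have e2 := hf.intCast_lt_iff (η k) (-z)
      push_cast at e1 e2
      split_ifs at hm ⊢
      · exact neg_le.1 (e1.2 (neg_le.1 hm))
      · exact neg_lt.1 (e2.2 (neg_lt.1 hm))
    · split_ifs <;> simp only [Set.mem_Iic, Set.mem_Iio] <;> linarith
  rcases hg a ha with h0 | h0
  · rw [h0, ClockVal.val_zero, zero_sub] at h1 ⊢
    rcases Fin.eq_zero_or_eq_succ a.j with hj | ⟨k, hj⟩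
    · rw [hj] at h1 ⊢; exact h1
    · rw [hj] at h1 ⊢; exact lower k h1
  · rw [h0, ClockVal.val_zero, sub_zero] at h1 ⊢
    rcases Fin.eq_zero_or_eq_succ a.i with hi | ⟨k, hi⟩
    · rw [hi] at h1 ⊢; exact h1
    · rw [hi] at h1 ⊢; exact upper k h1

/-- Among infinitely many clock valuations, some later one is related to an earlier one. -/
theorem exists_regionRel (K : ℕ) (f : ℕ → ClockVal n) :
    ∃ a b, a < b ∧ RegionRel K (f b) (f a) := by
  -- The region of a valuation: integer parts cut off at `K + 1`, which fractional parts are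
  -- nonzero, and their order. There are finitely many regions.
  let sig : ClockVal n → (Fin n → Fin (K + 2)) × (Fin n → Prop) × (Fin n → Fin n → Prop) := fun η =>
    (fun k => ⟨min ⌊(η k : ℝ)⌋₊ (K + 1), by omega⟩, fun k => 0 < Int.fract (η k : ℝ),
      fun k l => Int.fract (η k : ℝ) < Int.fract (η l : ℝ))
  obtain ⟨a, b, hab, heq⟩ : ∃ a b, a < b ∧ sig (f a) = sig (f b) := by
    obtain ⟨a, b, hne, heq⟩ := Finite.exists_ne_map_eq_of_infinite fun k => sig (f k)
    rcases hne.lt_or_gt with h | h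
    exacts [⟨a, b, h, heq⟩, ⟨b, a, h, heq.symm⟩]
  refine ⟨a, b, hab, ?_⟩
  generalize f a = η' at heq
  generalize f b = η at heq
  have h1 := congrArg Prod.fst heq
  have h2 := congrArg (fun s => s.2.1) heq
  have h3 := congrArg (fun s => s.2.2) heq
  obtain ⟨g, hg, hgv⟩ := exists_isTimeWarp (fun k => Int.fract (η k : ℝ))
    (fun k => Int.fract (η' k : ℝ)) (fun k => Int.fract_nonneg _) (fun k => Int.fract_lt_one _)
    (fun k => Int.fract_nonneg _) (fun k => Int.fract_lt_one _)
    (fun k => (congrFun h2 k).symm.to_iff) (fun k l => (congrFun (congrFun h3 k) l).symm.to_iff)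
  refine ⟨g, hg, fun k => ?_⟩
  have hfl : min ⌊(η' k : ℝ)⌋₊ (K + 1) = min ⌊(η k : ℝ)⌋₊ (K + 1) := by
    exact congrArg Fin.val (congrFun h1 k)
  by_cases hK : ⌊(η k : ℝ)⌋₊ < K + 1
  · left
    have hfl' : ⌊(η' k : ℝ)⌋₊ = ⌊(η k : ℝ)⌋₊ := by omega
    have e : ∀ x : ℝ≥0, (x : ℝ) = Int.fract (x : ℝ) + (⌊(x : ℝ)⌋₊ : ℝ) := fun x => by
      rw [natCast_floor_eq_intCast_floor x.coe_nonneg, Int.fract_add_floor]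
    calc g (η k) = g (Int.fract (η k : ℝ) + (⌊(η k : ℝ)⌋₊ : ℝ)) := congrArg g (e _)
      _ = Int.fract (η' k : ℝ) + (⌊(η' k : ℝ)⌋₊ : ℝ) := by rw [hg.add_natCast, hgv, hfl']
      _ = η' k := (e _).symm
  · right
    have lt : ∀ x : ℝ≥0, K + 1 ≤ ⌊(x : ℝ)⌋₊ → (K : ℝ) < x := fun x hx => by
      have := (Nat.le_floor_iff x.coe_nonneg).1 hx
      push_cast at this
      exact (lt_add_one _).trans_le this
    exact ⟨lt _ (by omega), lt _ (by omega)⟩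

theorem exists_natAbs_le (g : Guard P n) (v : P → ℤ) :
    ∃ K : ℕ, ∀ a ∈ g, (a.expr.eval v).natAbs ≤ K := by
  induction g with
  | nil => exact ⟨0, by simp⟩
  | cons a g ih =>
    obtain ⟨K, hK⟩ := ih
    refine ⟨max K (a.expr.eval v).natAbs, fun b hb => ?_⟩
    rcases List.mem_cons.1 hb with rfl | hb
    exacts [le_max_right _ _, (hK b hb).trans (le_max_left _ _)]

/-- Time-abstracting simulation admits no infinite sequence of states of one location in which
no later state is simulated by an earlier one. -/
theorem Automaton.exists_simulated [Finite L] (A : Automaton L P n) (v : P → ℤ)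
    (f : ℕ → State L n) {l : L} (hf : ∀ i, (f i).1 = l) :
    ∃ a b, a < b ∧ A.Simulated v (f b) (f a) := by
  -- `max K₁ K₂` bounds the constants, evaluated under `v`, of all guards and invariants.
  choose kg hkg using fun g : Guard P n => exists_natAbs_le g v
  obtain ⟨K₁, hK₁⟩ := (A.trans.image fun t => kg t.2.1.1).exists_le
  obtain ⟨K₂, hK₂⟩ := (Set.finite_range fun l => kg (A.inv l).1).bddAbove
  obtain ⟨a, b, hab, hR⟩ := exists_regionRel (max K₁ K₂) fun i => (f i).2
  refine ⟨a, b, hab, fun s s' => s'.1 = s.1 ∧ RegionRel (max K₁ K₂) s.2 s'.2, ⟨?_, ?_⟩,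
    (hf a).trans (hf b).symm, hR⟩
  · rintro ⟨l₁, η₁⟩ ⟨_, η₂⟩ ⟨l₁', η₁'⟩ ⟨rfl, h⟩ ⟨g, R, htr, hg, rfl, hinv⟩
    refine ⟨(l₁', η₂.reset R), rfl, ⟨g, R, htr, ?_, rfl, ?_⟩, rfl, h.reset R⟩
    · exact h.sat g.2 (fun c hc => (hkg _ c hc).trans
        ((hK₁ _ (Finset.mem_image_of_mem _ htr)).trans (le_max_left _ _))) hg
    · exact (h.reset R).sat (A.inv l₁').2 (fun c hc => (hkg _ c hc).trans
        ((hK₂ ⟨l₁', rfl⟩).trans (le_max_right _ _))) hinv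
  · rintro ⟨l₁, η₁⟩ ⟨l₂, η₂⟩ ⟨l₁', η₁'⟩ d ⟨h2, h⟩ ⟨h1, h3, hinv⟩
    obtain rfl : l₂ = l₁ := h2
    obtain rfl : l₁' = l₂ := h1
    obtain rfl : η₁' = η₁.delay d := h3
    obtain ⟨d', h'⟩ := h.delay d
    refine ⟨d', (l₁', η₂.delay d'), ⟨rfl, rfl, ?_⟩, rfl, h'⟩
    exact h'.sat (A.inv l₁').2 (fun c hc => (hkg _ c hc).trans
        ((hK₂ ⟨l₁', rfl⟩).trans (le_max_right _ _))) hinv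

end Regions

/-! ### From abstract runs to concrete runs -/

section Lasso

variable {L P : Type*} [Fintype P] {n : ℕ} {v : P → ℤ} {A : Automaton L P n}

/-- An action followed by a delay. -/
def Automaton.Step (A : Automaton L P n) (v : P → ℤ) (s t : State L n) : Prop :=
  ∃ m d, A.ActStep v s m ∧ A.DelayStep v d m t

/-- `t` is reached from `s` by a path of steps whose source locations form the word `w`. -/
def Automaton.Follows (A : Automaton L P n) (v : P → ℤ) :
    List L → State L n → State L n → Prop
  | [], s, t => s = t
  | l :: w, s, t => s.1 = l ∧ ∃ u, A.Step v s u ∧ Automaton.Follows A v w u t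

theorem Automaton.Simulated.trans {s t u : State L n} (h : A.Simulated v s t)
    (h' : A.Simulated v t u) : A.Simulated v s u := by
  obtain ⟨R, hR, hst⟩ := h
  obtain ⟨R', hR', htu⟩ := h'
  refine ⟨Relation.Comp R R', ⟨?_, ?_⟩, t, hst, htu⟩
  · rintro s₁ s₂ s₁' ⟨m, h1, h2⟩ hs
    obtain ⟨m', hl, hm, h3⟩ := hR.action _ _ _ h1 hs
    obtain ⟨s₂', hl', hs', h4⟩ := hR'.action _ _ _ h2 hm
    exact ⟨s₂', hl'.trans hl, hs', m', h3, h4⟩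
  · rintro s₁ s₂ s₁' d₁ ⟨m, h1, h2⟩ hs
    obtain ⟨d, m', hm, h3⟩ := hR.delay _ _ _ _ h1 hs
    obtain ⟨d₂, s₂', hs', h4⟩ := hR'.delay _ _ _ _ h2 hm
    exact ⟨d₂, s₂', hs', m', h3, h4⟩

theorem Automaton.Simulated.refl (A : Automaton L P n) (v : P → ℤ) (s : State L n) :
    A.Simulated v s s :=
  ⟨Eq, ⟨fun s₁ _ s₁' h hs => ⟨s₁', by rw [h], h ▸ hs, rfl⟩,
    fun s₁ _ s₁' d h hs => ⟨d, s₁', h ▸ hs, rfl⟩⟩, rfl⟩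

theorem Automaton.Simulated.step {s s' t : State L n} (h : A.Simulated v s s')
    (hst : A.Step v s t) : s'.1 = s.1 ∧ ∃ t', A.Step v s' t' ∧ A.Simulated v t t' := by
  obtain ⟨R, hR, hs⟩ := h
  obtain ⟨m, d, ha, hd⟩ := hst
  obtain ⟨m', hl, ha', hm⟩ := hR.action _ _ _ hs ha
  obtain ⟨d', t', hd', ht⟩ := hR.delay _ _ _ _ hm hd
  exact ⟨hl, t', ⟨m', d', ha', hd'⟩, R, hR, ht⟩

theorem Automaton.Simulated.follows {w : List L} {s s' t : State L n} (h : A.Simulated v s s')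
    (hst : A.Follows v w s t) : ∃ t', A.Follows v w s' t' ∧ A.Simulated v t t' := by
  induction w generalizing s s' with
  | nil =>
    obtain rfl : s = t := hst
    exact ⟨s', rfl, h⟩
  | cons l w ih =>
    obtain ⟨rfl, u, hu, hut⟩ := hst
    obtain ⟨hl, u', hu', huu⟩ := h.step hu
    obtain ⟨t', ht', htt⟩ := ih huu hut
    exact ⟨t', ⟨hl, u', hu', ht'⟩, htt⟩

theorem Automaton.Follows.append {w w' : List L} {s t u : State L n} (h : A.Follows v w s t)
    (h' : A.Follows v w' t u) : A.Follows v (w ++ w') s u := by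
  induction w generalizing s with
  | nil =>
    obtain rfl : s = t := h
    exact h'
  | cons l w ih =>
    obtain ⟨hl, r, hr, hrt⟩ := h
    exact ⟨hl, r, hr, ih hrt⟩

/-- Some infinite path of steps from `s` visits accepting locations infinitely often. -/
def Automaton.AcceptsFrom (A : Automaton L P n) (v : P → ℤ) (s : State L n) : Prop :=
  ∃ f : ℕ → State L n, f 0 = s ∧ (∀ i, A.Step v (f i) (f (i + 1))) ∧
    {i | (f i).1 ∈ A.acc}.Infinite

theorem Automaton.AcceptsFrom.of_step {s t : State L n} (h : A.Step v s t)
    (ht : A.AcceptsFrom v t) : A.AcceptsFrom v s := by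
  obtain ⟨f, rfl, hf, hacc⟩ := ht
  refine ⟨fun i => Nat.casesOn i s f, rfl, fun i => ?_, ?_⟩
  · cases i with
    | zero => exact h
    | succ i => exact hf i
  · refine (hacc.image (f := Nat.succ) Nat.succ_injective.injOn).mono ?_
    rintro _ ⟨i, hi, rfl⟩
    exact hi

theorem Automaton.AcceptsFrom.of_follows {w : List L} {s t : State L n} (h : A.Follows v w s t)
    (ht : A.AcceptsFrom v t) : A.AcceptsFrom v s := by
  induction w generalizing s with
  | nil =>
    obtain rfl : s = t := h
    exact ht
  | cons l w ih =>
    obtain ⟨-, u, hu, hut⟩ := h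
    exact (ih hut).of_step hu

/-- A path from `x` through an accepting location to a state that simulates `x` can be repeated
from every state that simulates `x`. -/
theorem Automaton.acceptsFrom_of_loop {x x' y : State L n} {w : List L}
    (hw : A.Follows v w x x') (hx : A.Simulated v x x') {l : L} (hl : l ∈ w) (hacc : l ∈ A.acc)
    (hy : A.Simulated v x y) : A.AcceptsFrom v y := by
  have hpos : 0 < w.length := List.length_pos_of_mem hl
  -- After `i` steps of the repeated word, the rest of the current copy of `w` leads to a state that
  -- simulates `x`, where the next copy can start.
  let I : ℕ → State L n → Prop := fun i z =>
    ∃ z', A.Follows v (w.drop (i % w.length)) z z' ∧ A.Simulated v x z'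
  have hloop : ∀ z, A.Simulated v x z → ∃ z', A.Follows v w z z' ∧ A.Simulated v x z' := by
    intro z hz
    obtain ⟨z', h1, h2⟩ := hz.follows hw
    exact ⟨z', h1, hx.trans h2⟩
  have hstep : ∀ i z, I i z → z.1 = w[i % w.length]'(Nat.mod_lt _ hpos) ∧
      ∃ z', A.Step v z z' ∧ I (i + 1) z' := by
    rintro i z ⟨t, ht, hxt⟩
    have hlt := Nat.mod_lt i hpos
    rw [List.drop_eq_getElem_cons hlt] at ht
    obtain ⟨h1, u, hu, hut⟩ := ht
    refine ⟨h1, u, hu, ?_⟩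
    show ∃ z', A.Follows v (w.drop ((i + 1) % w.length)) u z' ∧ A.Simulated v x z'
    by_cases hlast : i % w.length + 1 = w.length
    · have h0 : (i + 1) % w.length = 0 := by
        rw [← Nat.mod_add_mod, hlast, Nat.mod_self]
      rw [h0, List.drop_zero]
      rw [hlast, List.drop_length] at hut
      obtain rfl : u = t := hut
      exact hloop u hxt
    · have h0 : (i + 1) % w.length = i % w.length + 1 := by
        rw [← Nat.mod_add_mod, Nat.mod_eq_of_lt (by omega)]
      rw [h0]
      exact ⟨t, hut, hxt⟩
  choose hloc f hf hI using hstep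
  let F : (i : ℕ) → {z : State L n // I i z} := fun i =>
    Nat.rec ⟨y, by simpa [I] using hloop y hy⟩ (fun i z => ⟨f i z.1 z.2, hI i z.1 z.2⟩) i
  refine ⟨fun i => (F i).1, rfl, fun i => hf i (F i).1 (F i).2, ?_⟩
  obtain ⟨j, hj, rfl⟩ := List.getElem_of_mem hl
  refine Set.infinite_of_injective_forall_mem (f := fun k => j + w.length * k) ?_ fun k => ?_
  · intro a b hab
    exact Nat.eq_of_mul_eq_mul_left hpos (Nat.add_left_cancel hab)
  · have h1 := hloc (j + w.length * k) (F (j + w.length * k)).1 (F (j + w.length * k)).2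
    simp only [Nat.add_mul_mod_self_left, Nat.mod_eq_of_lt hj] at h1
    show (F (j + w.length * k)).1.1 ∈ A.acc
    rw [h1]
    exact hacc

/-- Regrouping: a path of action-delay steps lists the states after delays, and the states between
action and delay become the states `s i` of the run. -/
theorem Automaton.AcceptsFrom.hasAcceptingRun {s : State L n} {d : ℝ≥0}
    (hd : A.DelayStep v d (A.init, fun _ => 0) s) (hs : A.AcceptsFrom v s) :
    A.HasAcceptingRun v := by
  obtain ⟨f, rfl, hf, hacc⟩ := hs
  choose m e hm he using hf
  refine ⟨fun i => Nat.casesOn i (A.init, fun _ => 0) m, f, fun i => Nat.casesOn i d e,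
    ⟨rfl, fun i => ?_, hm⟩, ?_⟩
  · cases i with
    | zero => exact hd
    | succ i => exact he i
  · convert hacc using 3 with i
    cases i with
    | zero => exact Iff.of_eq (congrArg (· ∈ A.acc) hd.1.symm)
    | succ i => exact Iff.of_eq (congrArg (· ∈ A.acc) (he i).1.symm)

variable {lb ub : P → ℤ} {α : SymState L n lb ub → Set (SymState L n lb ub)}

/-- Abstract paths are followed backwards by concrete ones, up to simulation. -/
theorem Automaton.exists_follows_of_absPath (hα : A.IsAbstraction α)
    (hA : A.InvariantsHoldOnEntry v) {Q S : ℕ → SymState L n lb ub}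
    (hQS : ∀ i, Q i ∈ α (S i)) (hstep : ∀ i, A.SymStep (Q i) (S (i + 1)))
    (k i : ℕ) {s : State L n} (hs : (Q (i + k)).Contains v s) :
    ∃ t s', (Q i).Contains v t ∧
      A.Follows v ((List.range' i k).map fun m => (Q m).loc) t s' ∧ A.Simulated v s s' := by
  induction k generalizing i with
  | zero => exact ⟨s, s, hs, rfl, Simulated.refl A v s⟩
  | succ k ih =>
    obtain ⟨t, s', ht, hw, hss⟩ := ih (i + 1) (by rwa [add_assoc, add_comm 1 k])
    -- A state that only the abstraction added need not have a predecessor; the state of `S (i + 1)`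
    -- that simulates it does.
    obtain ⟨t', ht', htt⟩ := hα.simulated _ _ (hQS (i + 1)) v t ht
    obtain ⟨u, m, d, hu, ha, hd⟩ := A.exists_step_of_symStep hA (hstep i) ht'
    obtain ⟨s'', hw', hs''⟩ := htt.follows hw
    exact ⟨u, s'', hu, ⟨hu.1, t', ⟨m, d, ha, hd⟩, hw'⟩, hss.trans hs''⟩

theorem Automaton.HasAbsAcceptingRun.hasAcceptingRun [Finite L] (hα : A.IsAbstraction α)
    (hfin : (Set.range α).Finite) (hA : A.InvariantsHoldOnEntry v)
    (h : A.HasAbsAcceptingRun α v) : A.HasAcceptingRun v := by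
  obtain ⟨Q, ⟨S₀, hS₀, hQ₀⟩, hstep, hv, hacc⟩ := h
  choose S' hS' hQ' using hstep
  let S : ℕ → SymState L n lb ub := fun i => Nat.casesOn i S₀ S'
  have hQS : ∀ i, Q i ∈ α (S i) := by
    intro i
    cases i with
    | zero => exact hQ₀
    | succ i => exact hQ' i
  have hSQ : ∀ i s, (S i).Contains v s → (Q i).Contains v s := fun i s hs =>
    ⟨hs.1.trans (hα.loc_eq _ _ (hQS i)).symm, hα.zone_subset _ _ (hQS i) v (hv i) _ hs.2⟩
  have back := fun k i s => A.exists_follows_of_absPath hα hA (S := S) hQS hS' k i (s := s)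
  -- The pigeonhole acts on the sets `α (S i)`, because the symbolic states `Q i` may be infinitely
  -- many.
  obtain ⟨p, q, m, hpm, hmq, hm, hpq⟩ :
      ∃ p q m, p ≤ m ∧ m < q ∧ (Q m).loc ∈ A.acc ∧ α (S p) = α (S q) := by
    have := hfin.to_subtype
    obtain ⟨X, hX⟩ := Finite.exists_infinite_fiber fun i : ℕ =>
      (⟨α (S i), Set.mem_range_self _⟩ : Set.range α)
    have hinf := Set.infinite_coe_iff.1 hX
    obtain ⟨p, hp⟩ := hinf.nonempty
    obtain ⟨m, hm, hpm⟩ := hacc.exists_gt p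
    obtain ⟨q, hq, hmq⟩ := hinf.exists_gt m
    refine ⟨p, q, m, hpm.le, hmq, hm, ?_⟩
    exact congrArg Subtype.val ((show _ = X from hp).trans (show _ = X from hq).symm)
  obtain ⟨k, rfl⟩ := Nat.exists_eq_add_of_le (hpm.trans hmq.le)
  set w := (List.range' p k).map fun m => (Q m).loc with hw
  have hmw : (Q m).loc ∈ w := List.mem_map.2 ⟨m, List.mem_range'_1.2 ⟨hpm, hmq⟩, rfl⟩
  have hround : ∀ s : {s // (Q p).Contains v s}, ∃ t : {s // (Q p).Contains v s}, ∃ s',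
      A.Follows v w t s' ∧ A.Simulated v s s' := by
    rintro ⟨s, hs⟩
    -- Here the repetition is used: `Q p` also belongs to `α (S q)`, so `s` is simulated by a state
    -- of `S q`, from which one walks back to `Q p`.
    obtain ⟨s₁, h1, h2⟩ := hα.simulated (S (p + k)) (Q p) (hpq ▸ hQS p) v s hs
    obtain ⟨t, s', ht, hts, hs'⟩ := back k p _ (hSQ _ _ h1)
    exact ⟨⟨t, ht⟩, s', hts, h2.trans hs'⟩
  choose pre hpre using hround
  obtain ⟨η, hη⟩ := hv p
  let f : ℕ → {s // (Q p).Contains v s} := fun i => pre^[i] ⟨((Q p).loc, η), rfl, hη⟩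
  have hf : ∀ k a, ∃ s', A.Follows v (List.replicate k w).flatten (f (a + k)) s' ∧
      A.Simulated v (f a) s' := by
    intro k a
    induction k with
    | zero => exact ⟨f a, rfl, Simulated.refl A v _⟩
    | succ k ih =>
      obtain ⟨s', h1, h2⟩ := ih
      obtain ⟨s'', h3, h4⟩ := hpre (f (a + k))
      obtain ⟨r, h5, h6⟩ := h4.follows h1
      refine ⟨r, ?_, h2.trans h6⟩
      rw [List.replicate_succ, List.flatten_cons]
      rw [← add_assoc]
      have : f (a + k + 1) = pre (f (a + k)) := Function.iterate_succ_apply' _ _ _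
      rw [this]
      exact h3.append h5
  -- With `b = a + c + 1`, the word `w ^ (c + 1)` leads from `f b` to `x'`, and `f b ≼ f a ≼ x'`
  -- closes the loop.
  obtain ⟨a, b, hab, hsim⟩ := A.exists_simulated v (fun i => (f i).1) fun i => (f i).2.1
  obtain ⟨c, rfl⟩ := Nat.exists_eq_add_of_lt hab
  obtain ⟨x', hx, hxx⟩ := hf (c + 1) a
  -- The stem: a backward walk from `f b` to `Q 0`, transferred to a state of the initial `S 0`. It
  -- ends in a state that simulates `f b`, which suffices to enter the loop.
  obtain ⟨t, x₁, ht, hw₀, hx₁⟩ := back p 0 _ (by rw [zero_add]; exact (f (a + (c + 1))).2)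
  obtain ⟨t', ht', htt⟩ := hα.simulated _ _ (hQS 0) v t ht
  obtain ⟨x₂, hw₁, hx₂⟩ := htt.follows hw₀
  obtain ⟨d, hd⟩ := A.exists_delayStep_of_symInit (S := S 0) hS₀ ht'
  refine AcceptsFrom.hasAcceptingRun hd (AcceptsFrom.of_follows hw₁ ?_)
  refine Automaton.acceptsFrom_of_loop hx (hsim.trans hxx) (l := (Q m).loc) ?_ hm (hx₁.trans hx₂)
  rw [List.replicate_succ, List.flatten_cons]
  exact List.mem_append_left _ hmw

end Lasso

end PTBA

theorem mainTheorem3 {L P : Type*} [Finite L] [Fintype P] {n : ℕ} (A : PTBA.Automaton L P n)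
    (lb ub : P → ℤ) (α : PTBA.SymState L n lb ub → Set (PTBA.SymState L n lb ub))
    (hα : A.IsAbstraction α) (hfin : (Set.range α).Finite)
    (v : P → ℤ) (hv : PTBA.Bounded lb ub v) :
    (A.HasAcceptingRun v → A.HasAbsAcceptingRun α v) ∧
    (A.InvariantsHoldOnEntry v → (A.HasAcceptingRun v ↔ A.HasAbsAcceptingRun α v)) :=
  ⟨fun h => h.hasAbsAcceptingRun hα hv,
    fun hA => ⟨fun h => h.hasAbsAcceptingRun hα hv, fun h => h.hasAcceptingRun hα hfin hA⟩⟩
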